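/- **Problem.** Let $N\ge 1$, $\mathcal X=\mathcal X_1\times\cdots\times\mathcal X_N$ with $\mathcal X_i\subseteq\mathbb R^{n_i}$, and consider $\min_{x\in\mathcal X}F(x)$, $F(x)=f(x)+g(x)$, $g(x)=\sum_{i=1}^N g_i(x_i)$. A point $x\in\mathcal X$ is *stationary* if $\nabla f(x)^T(y-x)+g(y)-g(x)\ge 0$ for all $y\in\mathcal X$. All norms are Euclidean. **Assumption A.** Each $\mathcal X_i$ is nonempty, closed and convex; $f$ is $C^1$ on an open set containing $\mathcal X$; each $\nabla_{x_i}f$ is $L_f$-Lipschitz on $\mathcal X$; each $g_i$ is convex and $L_g$-Lipschitz on $\mathcal X_i$; $F(x)\to+\infty$ as $\|x\|\to\infty$, $x\in\mathcal X$. **Assumption B.** The surrogates $\tilde f_i(\cdot\,;\cdot)$ satisfy, with $\nabla\tilde f_i$ the gradient in the first argument: for $y\in\mathcal X$, $\tilde f_i(\cdot\,;y)$ is $C^1$ on an open set containing $\mathcal X_i$ and $c_{\tilde f}$-strongly convex on $\mathcal X_i$ ($c_{\tilde f}>0$); $\nabla\tilde f_i(y_i;y)=\nabla_{x_i}f(y)$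 for $y\in\mathcal X$; $\nabla\tilde f_i(z;\cdot)$ is $L_B$-Lipschitz on $\mathcal X$ for $z\in\mathcal X_i$; $\nabla\tilde f_i(\cdot\,;y)$ is $L_E$-Lipschitz on $\mathcal X_i$ for $y\in\mathcal X$. **Algorithm (AsyFLEXA).** Let $\mathcal D$ be a finite set of delay vectors $d\in\mathbb N^N$, and let $P$ be a probability measure on the space of sequences $\omega=(\omega^k)_{k\ge0}=(i^k,d^k)_{k\ge 0}$ in $\{1,\dots,N\}\times\mathcal D$, with the $\sigma$-algebra generated by the cylinders. Given $x^0\in\mathcal X$ and $\gamma\in(0,1]$, put $x^{k-d^k}=(x_1^{k-d_1^k},\dots,x_N^{k-d_N^k})$ (with $x^l=x^0$ for $l<0$) and $$x^{k+1}_{i^k}=x^k_{i^k}+\gamma\big(\hat x_{i^k}(x^{k-d^k})-x^k_{i^k}\big),\qquad x^{k+1}_j=x^k_j\ (j\ne i^k),\qquad \hat x_i(y)=\operatorname*{argmin}_{z\in\mathcal X_i}\ \tilde f_i(z;y)+g_i(z).$$ **Assumption C.** There are integers $\delta\ge0$, $T\ge1$ and $p_{\min}>0$ such that: all delays satisfy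 $d_i\le\delta$; for every block $i$, every $k\ge 0$ and every $\omega$ there is $t\in\{0,\dots,T\}$ such that the conditional probability that block $i$ is chosen at iteration $k+t$, given $\omega^{0},\dots,\omega^{k+t-1}$, is at least $p_{\min}$, if that history has positive probability; and almost surely $d^k_{i^k}=0$ for all $k$. **Notation.** $F^*=\min_{\mathcal X}F$; $$M_F(x)=x-\operatorname*{argmin}_{y\in\mathcal X}\Big\{\nabla f(x)^T(y-x)+g(y)+\tfrac12\|y-x\|^2\Big\};$$ $K_\epsilon$ is the first $k$ with $\mathbb E\|M_F(x^k)\|^2\le\epsilon$; $\mathcal K_i^k$ is the set of iterations $t\ge 0$ in $[k-\delta,k+T-1]$ with $i^t=i$; $\bar{\mathcal K}_i^k=\mathcal K_i^k\cap[k-\delta,k-1]$; $M_i^k=\max_{l=k,\dots,k+T}|\bar{\mathcal K}_i^l|$; and $$\tilde F^k=F(x^k)+\delta\frac{L_f}{2}\sum_{l=k-\delta}^{k-1}\big(l-(k-1)+\delta\big)\|x^{l+1}-x^l\|^2 .$$ **Theorem 1.** Suppose Assumptions A, B, C hold and $\gamma<\dfrac{c_{\tilde f}}{L_f+\delta^2L_f/2}$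 (no restriction if $L_f=0$). Then: (a) almost surely, every limit point of $\{x^k\}$ is stationary; (b) almost surely, $\{F(x^k)\}$ converges; (c) for every $\epsilon>0$ the index $K_\epsilon$ exists, and $K_\epsilon\le C/\epsilon$ with $C$ independent of $\epsilon$. Moreover, if $\delta\ge1$, then for every $\alpha\in(0,1)$ and $\epsilon>0$ $$K_\epsilon\le\frac{C_1(T+1)(F(x^0)-F^*)}{\epsilon}+\frac{C_2\gamma^2}{\epsilon}\sum_{k=0}^{K_\epsilon}\mathbb E\Big(\sum_{i=1}^N M_i^k\sum_{t\in\mathcal K_i^k}\big(\tilde F^t-\tilde F^{t+1}\big)\Big),$$ $$C_1=\frac{2\big(1+(1+L_E)(1+L_B+L_E)+\gamma^2Np_{\min}\alpha^{-1}(1+(L_f+1)^2)\big)}{\gamma\big(c_{\tilde f}-\gamma(L_f+\frac{\delta^2L_f}{2})\big)(p_{\min}-p_{\min}\alpha)},\qquad C_2=\frac{2TL_B(1+L_B+L_E)}{\gamma\big(c_{\tilde f}-\gamma(L_f+\frac{\delta^2L_f}{2})\big)(p_{\min}-p_{\min}\alpha)} .$$ All the expectations exist. -/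

import Mathlib

open MeasureTheory Filter Topology
open scoped NNReal RealInnerProductSpace

namespace AsyFlexa

noncomputable section

/-- The space of block vectors `x = (x_1, …, x_N)` with `x_i ∈ ℝ^{n_i}`, with the Euclidean norm. -/
abbrev Vec {N : ℕ} (n : Fin N → ℕ) : Type :=
  PiLp 2 (fun i : Fin N => EuclideanSpace ℝ (Fin (n i)))

/-- The feasible set `𝒳 = 𝒳_1 × ⋯ × 𝒳_N`. -/
def feasible {N : ℕ} {n : Fin N → ℕ} (X : ∀ i, Set (EuclideanSpace ℝ (Fin (n i)))) :
    Set (Vec n) :=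
  {x | ∀ i, x i ∈ X i}

/-- The separable part `g(x) = ∑ g_i(x_i)`. -/
def sepSum {N : ℕ} {n : Fin N → ℕ} (g : ∀ i, EuclideanSpace ℝ (Fin (n i)) → ℝ) (x : Vec n) : ℝ :=
  ∑ i, g i (x i)

/-- The objective `F(x) = f(x) + ∑ g_i(x_i)`. -/
def objective {N : ℕ} {n : Fin N → ℕ} (f : Vec n → ℝ)
    (g : ∀ i, EuclideanSpace ℝ (Fin (n i)) → ℝ) (x : Vec n) : ℝ :=
  f x + sepSum g x

/-- The partial gradient `∇_{x_i} f (x)`: the `i`-th block of `∇ f (x)`. -/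
def blockGrad {N : ℕ} {n : Fin N → ℕ} (f : Vec n → ℝ) (i : Fin N) (x : Vec n) :
    EuclideanSpace ℝ (Fin (n i)) :=
  (gradient f x) i

/-- A minimizer of `φ` over `s` (the minimizer, where it exists and is unique). -/
def argmin {E : Type*} [Nonempty E] (s : Set E) (φ : E → ℝ) : E :=
  Classical.epsilon (fun z => z ∈ s ∧ IsMinOn φ s z)

/-- Stationary solutions of `min f(x) + g(x)` subject to `x ∈ 𝒳`. -/
def IsStationary {N : ℕ} {n : Fin N → ℕ} (X : ∀ i, Set (EuclideanSpace ℝ (Fin (n i))))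
    (f : Vec n → ℝ) (g : ∀ i, EuclideanSpace ℝ (Fin (n i)) → ℝ) (x : Vec n) : Prop :=
  x ∈ feasible X ∧
    ∀ y ∈ feasible X, 0 ≤ ⟪gradient f x, y - x⟫ + sepSum g y - sepSum g x

/-- The stationarity measure
`M_F(x) = x - argmin_{y ∈ 𝒳} { ∇f(x)ᵀ(y - x) + g(y) + ‖y - x‖² / 2 }`. -/
def statMap {N : ℕ} {n : Fin N → ℕ} (X : ∀ i, Set (EuclideanSpace ℝ (Fin (n i))))
    (f : Vec n → ℝ) (g : ∀ i, EuclideanSpace ℝ (Fin (n i)) → ℝ) (x : Vec n) : Vec n :=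
  x - argmin (feasible X)
    (fun y => ⟪gradient f x, y - x⟫ + sepSum g y + 1 / 2 * ‖y - x‖ ^ 2)

/-- Assumption A (on the problem). `O` is an open set on which `f` is `C¹`. -/
structure AssumptionA {N : ℕ} {n : Fin N → ℕ} (X : ∀ i, Set (EuclideanSpace ℝ (Fin (n i))))
    (O : Set (Vec n)) (f : Vec n → ℝ) (g : ∀ i, EuclideanSpace ℝ (Fin (n i)) → ℝ)
    (Lf Lg : ℝ≥0) : Prop where
  nonempty : ∀ i, (X i).Nonempty
  isClosed : ∀ i, IsClosed (X i)
  convex : ∀ i, Convex ℝ (X i)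
  isOpen : IsOpen O
  subset : feasible X ⊆ O
  smooth : ContDiffOn ℝ 1 f O
  lipschitz_grad : ∀ i, LipschitzOnWith Lf (blockGrad f i) (feasible X)
  convex_g : ∀ i, ConvexOn ℝ (X i) (g i)
  lipschitz_g : ∀ i, LipschitzOnWith Lg (g i) (X i)
  coercive : Tendsto (objective f g) (Bornology.cobounded (Vec n) ⊓ 𝓟 (feasible X)) atTop

/-- Assumption B (on the surrogates). `ft i z y` is `f̃_i(z; y)`; gradients of the surrogates are
taken with respect to the first argument. -/
structure AssumptionB {N : ℕ} {n : Fin N → ℕ} (X : ∀ i, Set (EuclideanSpace ℝ (Fin (n i))))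
    (f : Vec n → ℝ) (ft : ∀ i, EuclideanSpace ℝ (Fin (n i)) → Vec n → ℝ)
    (c : ℝ) (LB LE : ℝ≥0) : Prop where
  c_pos : 0 < c
  smooth : ∀ i, ∀ y ∈ feasible X, ∃ U : Set (EuclideanSpace ℝ (Fin (n i))),
    IsOpen U ∧ X i ⊆ U ∧ ContDiffOn ℝ 1 (fun z => ft i z y) U
  strongConvex : ∀ i, ∀ y ∈ feasible X, StrongConvexOn (X i) c (fun z => ft i z y)
  grad_consistent : ∀ i, ∀ y ∈ feasible X,
    gradient (fun z => ft i z y) (y i) = blockGrad f i y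
  lipschitz_base : ∀ i, ∀ z ∈ X i,
    LipschitzOnWith LB (fun y : Vec n => gradient (fun w => ft i w y) z) (feasible X)
  lipschitz_arg : ∀ i, ∀ y ∈ feasible X,
    LipschitzOnWith LE (fun z => gradient (fun w => ft i w y) z) (X i)

/-- The sample space of all sequences `ω = (i^k, d^k)_{k ≥ 0}` with values in `𝒩 × 𝒟`, where `𝒟` is
the (finite) set of possible delay vectors. It carries the product `σ`-algebra, which is the one
generated by the cylinders. -/
abbrev Sample {N : ℕ} (D : Finset (Fin N → ℕ)) : Type := ℕ → Fin N × D

/-- The cylinder of all sequences whose first `k` elements are those of `ω`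
(the whole space if `k = 0`). -/
def cylinder {N : ℕ} {D : Finset (Fin N → ℕ)} (k : ℕ) (ω : Sample D) : Set (Sample D) :=
  {ω' | ∀ t < k, ω' t = ω t}

/-- The conditional probability that element number `k` of the sequence is `a`, given that the
first `k` elements (numbers `0, …, k - 1`) are those of `ω`; it is `0` if the latter event is null.
For `k = 0` it is the unconditional probability. -/
def condProb {N : ℕ} {D : Finset (Fin N → ℕ)} (P : Measure (Sample D)) (k : ℕ) (ω : Sample D)
    (a : Fin N × D) : ℝ :=
  P.real (cylinder k ω ∩ {ω' | ω' k = a}) / P.real (cylinder k ω)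

/-- Assumption C (on the probabilistic model). -/
structure AssumptionC {N : ℕ} {D : Finset (Fin N → ℕ)} (P : Measure (Sample D)) (δ T : ℕ)
    (pmin : ℝ) : Prop where
  T_pos : 0 < T
  pmin_pos : 0 < pmin
  bounded_delay : ∀ d ∈ D, ∀ i, d i ≤ δ
  often : ∀ (i : Fin N) (ω : Sample D) (k : ℕ), ∃ t ≤ T,
    0 < P.real (cylinder (k + t) ω) → pmin ≤ ∑ d : D, condProb P (k + t) ω (i, d)
  own_block : ∀ᵐ ω ∂P, ∀ k : ℕ, (ω k).2.1 (ω k).1 = 0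

/-- The best response `x̂_i(y) = argmin_{z ∈ 𝒳_i} f̃_i(z; y) + g_i(z)`. -/
def bestResponse {N : ℕ} {n : Fin N → ℕ} (X : ∀ i, Set (EuclideanSpace ℝ (Fin (n i))))
    (g : ∀ i, EuclideanSpace ℝ (Fin (n i)) → ℝ)
    (ft : ∀ i, EuclideanSpace ℝ (Fin (n i)) → Vec n → ℝ) (i : Fin N) (y : Vec n) :
    EuclideanSpace ℝ (Fin (n i)) :=
  argmin (X i) (fun z => ft i z y + g i z)

/-- One update: block `i` of `x` moves towards the best response at the delayed point `y`. -/
def step {N : ℕ} {n : Fin N → ℕ} (X : ∀ i, Set (EuclideanSpace ℝ (Fin (n i))))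
    (g : ∀ i, EuclideanSpace ℝ (Fin (n i)) → ℝ)
    (ft : ∀ i, EuclideanSpace ℝ (Fin (n i)) → Vec n → ℝ) (γ : ℝ) (i : Fin N) (x y : Vec n) :
    Vec n :=
  WithLp.toLp 2 (Function.update (WithLp.ofLp x) i (x i + γ • (bestResponse X g ft i y - x i)))

/-- `history … ω k l` is the iterate `x^{k-l}` along the sample path `ω`, with the convention
`x^m = x^0` for `m < 0`. -/
def history {N : ℕ} {n : Fin N → ℕ} {D : Finset (Fin N → ℕ)}
    (X : ∀ i, Set (EuclideanSpace ℝ (Fin (n i))))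
    (g : ∀ i, EuclideanSpace ℝ (Fin (n i)) → ℝ)
    (ft : ∀ i, EuclideanSpace ℝ (Fin (n i)) → Vec n → ℝ) (γ : ℝ) (x0 : Vec n)
    (ω : Sample D) : ℕ → ℕ → Vec n
  | 0, _ => x0
  | k + 1, 0 =>
      step X g ft γ (ω k).1 (history X g ft γ x0 ω k 0)
        (WithLp.toLp 2 (fun j => history X g ft γ x0 ω k ((ω k).2.1 j) j))
  | k + 1, l + 1 => history X g ft γ x0 ω k l

/-- The iterate `x^k` of the algorithm along the sample path `ω`. -/
def iterate {N : ℕ} {n : Fin N → ℕ} {D : Finset (Fin N → ℕ)}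
    (X : ∀ i, Set (EuclideanSpace ℝ (Fin (n i))))
    (g : ∀ i, EuclideanSpace ℝ (Fin (n i)) → ℝ)
    (ft : ∀ i, EuclideanSpace ℝ (Fin (n i)) → Vec n → ℝ) (γ : ℝ) (x0 : Vec n)
    (ω : Sample D) (k : ℕ) : Vec n :=
  history X g ft γ x0 ω k 0

/-- With truncated subtraction, `history` at `(k, l)` is the iterate `x^{k-l}`. -/
theorem history_eq {N : ℕ} {n : Fin N → ℕ} {D : Finset (Fin N → ℕ)}
    (X : ∀ i, Set (EuclideanSpace ℝ (Fin (n i))))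
    (g : ∀ i, EuclideanSpace ℝ (Fin (n i)) → ℝ)
    (ft : ∀ i, EuclideanSpace ℝ (Fin (n i)) → Vec n → ℝ) (γ : ℝ) (x0 : Vec n)
    (ω : Sample D) (k l : ℕ) :
    history X g ft γ x0 ω k l = iterate X g ft γ x0 ω (k - l) := by
  induction k generalizing l with
  | zero => simp [history, iterate]
  | succ k ih =>
    cases l with
    | zero => rfl
    | succ l => simpa [history] using ih l

/-- The recursion of the algorithm: block `i^k` of `x^k` is updated with the best response at the
delayed vector `(x_j^{k - d_j^k})_j`. -/
theorem iterate_succ {N : ℕ} {n : Fin N → ℕ} {D : Finset (Fin N → ℕ)}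
    (X : ∀ i, Set (EuclideanSpace ℝ (Fin (n i))))
    (g : ∀ i, EuclideanSpace ℝ (Fin (n i)) → ℝ)
    (ft : ∀ i, EuclideanSpace ℝ (Fin (n i)) → Vec n → ℝ) (γ : ℝ) (x0 : Vec n)
    (ω : Sample D) (k : ℕ) :
    iterate X g ft γ x0 ω (k + 1) =
      step X g ft γ (ω k).1 (iterate X g ft γ x0 ω k)
        (WithLp.toLp 2 (fun j => iterate X g ft γ x0 ω (k - (ω k).2.1 j) j)) := by
  simp only [← history_eq]
  rfl

/-- The Lyapunov function `F̃(x^k, …, x^{k-δ})` along a sequence `x`, where `x^l = x^0` for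
`l < 0` (this is what `Int.toNat` does). -/
def lyapunov {N : ℕ} {n : Fin N → ℕ} (F : Vec n → ℝ) (δ : ℕ) (Lf : ℝ) (x : ℕ → Vec n) (k : ℕ) :
    ℝ :=
  F (x k) + δ * (Lf / 2) *
    ∑ l ∈ Finset.Ico ((k : ℤ) - δ) k,
      ((l : ℝ) - ((k : ℝ) - 1) + δ) * ‖x (l + 1).toNat - x l.toNat‖ ^ 2

/-- `𝒦_i^k`: the iterations in `[k - δ, k + T - 1]` (and `≥ 0`) at which block `i` is updated. -/
def updates {N : ℕ} {D : Finset (Fin N → ℕ)} (δ T : ℕ) (ω : Sample D) (i : Fin N) (k : ℕ) :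
    Finset ℕ :=
  (Finset.Ico (k - δ) (k + T)).filter (fun t => (ω t).1 = i)

/-- The elements of `𝒦_i^k` in `[k - δ, k - 1]`. -/
def pastUpdates {N : ℕ} {D : Finset (Fin N → ℕ)} (δ : ℕ) (ω : Sample D) (i : Fin N) (k : ℕ) :
    Finset ℕ :=
  (Finset.Ico (k - δ) k).filter (fun t => (ω t).1 = i)

/-- `M_i^k`: the maximum over `l = k, …, k + T` of the number of elements of `pastUpdates` at `l`. -/
def maxUpdates {N : ℕ} {D : Finset (Fin N → ℕ)} (δ T : ℕ) (ω : Sample D) (i : Fin N) (k : ℕ) : ℕ :=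
  (Finset.Icc k (k + T)).sup (fun l => (pastUpdates δ ω i l).card)

/-- The constant `C₁(γ, δ)`. -/
def constC1 (N δ : ℕ) (γ c Lf LB LE pmin α : ℝ) : ℝ :=
  2 * (1 + (1 + LE) * (1 + LB + LE) + γ ^ 2 * N * pmin * α⁻¹ * (1 + (Lf + 1) ^ 2)) /
    (γ * (c - γ * (Lf + (δ : ℝ) ^ 2 * Lf / 2)) * (pmin - pmin * α))

/-- The constant `C₂(γ, δ)`. -/
def constC2 (δ T : ℕ) (γ c Lf LB LE pmin α : ℝ) : ℝ :=
  2 * T * LB * (1 + LB + LE) /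
    (γ * (c - γ * (Lf + (δ : ℝ) ^ 2 * Lf / 2)) * (pmin - pmin * α))

/-- `E ‖M_F(x^k)‖²`. -/
def meanSqStat {N : ℕ} {n : Fin N → ℕ} {D : Finset (Fin N → ℕ)} (P : Measure (Sample D))
    (X : ∀ i, Set (EuclideanSpace ℝ (Fin (n i)))) (f : Vec n → ℝ)
    (g : ∀ i, EuclideanSpace ℝ (Fin (n i)) → ℝ)
    (ft : ∀ i, EuclideanSpace ℝ (Fin (n i)) → Vec n → ℝ) (γ : ℝ) (x0 : Vec n) (k : ℕ) : ℝ :=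
  ∫ ω, ‖statMap X f g (iterate X g ft γ x0 ω k)‖ ^ 2 ∂P

/-- `K_ε`: the first iteration with `E ‖M_F(x^k)‖² ≤ ε`. -/
def firstIter {N : ℕ} {n : Fin N → ℕ} {D : Finset (Fin N → ℕ)} (P : Measure (Sample D))
    (X : ∀ i, Set (EuclideanSpace ℝ (Fin (n i)))) (f : Vec n → ℝ)
    (g : ∀ i, EuclideanSpace ℝ (Fin (n i)) → ℝ)
    (ft : ∀ i, EuclideanSpace ℝ (Fin (n i)) → Vec n → ℝ) (γ : ℝ) (x0 : Vec n) (ε : ℝ) : ℕ :=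
  sInf {k : ℕ | meanSqStat P X f g ft γ x0 k ≤ ε}

/-- The random variable
`∑_i M_i^k ∑_{t ∈ 𝒦_i^k} (F̃(x^t, …, x^{t-δ}) - F̃(x^{t+1}, …, x^{t+1-δ}))`. -/
def weightedDecrease {N : ℕ} {n : Fin N → ℕ} {D : Finset (Fin N → ℕ)} (F : Vec n → ℝ) (δ T : ℕ)
    (Lf : ℝ) (x : ℕ → Vec n) (ω : Sample D) (k : ℕ) : ℝ :=
  ∑ i : Fin N, (maxUpdates δ T ω i k : ℝ) *
    ∑ t ∈ updates δ T ω i k, (lyapunov F δ Lf x t - lyapunov F δ Lf x (t + 1))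

end

end AsyFlexa

/-! Along a path whose own-block delays vanish, each iteration lowers the Lyapunov function by at
least a positive rate times the squared distance of the updated block to its best response
(`IsRun.lyapunov_decrease`). Strong convexity supplies the decrease. The cross term caused by
outdated blocks is paid for by the loss of weight in the memory term, and the step-size condition is
exactly positivity of the rate that remains. Since `F` is bounded below, the squared gaps are
summable. Hence the memory term tends to zero, which gives (b).

The gaps control `M_F` only in the block being updated, up to delay errors (`statMap_block_le`,
`IsRun.sum_statMap_updated_le`). Two further ideas reach the full norm. Randomness: `x^k` is
determined by the history before `k`, and given that history each block is chosen during `k, …, k +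
T` with conditional probability at least `pmin`. So `pmin * E ‖M_F(x^k)‖²` is at most the
expectation of the part of `‖M_F(x^k)‖²` in the blocks chosen in this window
(`pmin_mul_meanSqStat_le`). Drift: a block of `M_F(x^k)` is compared with the same block at its
first update in the window; in between only other blocks move. When block `j` moves, the remaining
blocks of `M_F` jointly move by at most `L = min(L_f, L_B)` times the step
(`AssumptionA.sum_statMap_sub_le`). Indeed block `j` of the gradient is `L`-Lipschitz in the other
blocks, and symmetry of second differences transfers the same constant to the transposed dependence,
without a factor `N`.

Together these give the pathwise bound `IsRun.sum_windowStat_le`, whose constants rest on the scalar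
inequality `weight_bound`. In expectation, `E ‖M_F(x^k)‖²` is summable. This gives the `O(1/ε)`
bound directly, and almost sure convergence of `M_F(x^k)` to zero by Tonelli; continuity of `M_F`
then gives (a). For the explicit bound, gaps summed over windows are dominated by Lyapunov
decreases, and for `δ ≥ 1` the multiplicities `M_i^k` are at least one wherever they matter. The
factor `1 - α` and the term with `N` in `C₁` only weaken the estimate. -/

namespace AsyFlexa

/-! ### First-order conditions, strong convexity and quadratic bounds. -/

section Calculus

variable {E : Type*} [NormedAddCommGroup E] [InnerProductSpace ℝ E] [CompleteSpace E]

theorem hasDerivAt_lineMap_of_hasGradientAt {φ : E → ℝ} {G p v : E} {t : ℝ}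
    (h : HasGradientAt φ G (p + t • v)) :
    HasDerivAt (fun s : ℝ => φ (p + s • v)) ⟪G, v⟫ t := by
  have h1 : HasDerivAt (fun s : ℝ => p + s • v) v t := by
    simpa using ((hasDerivAt_id t).smul_const v).const_add p
  have h2 := (hasGradientAt_iff_hasFDerivAt.1 h).comp_hasDerivAt t h1
  simpa [Function.comp_def] using h2

/-- An upper bound on the increments of `φ` along `v` is inherited by the directional derivative. -/
theorem inner_gradient_le_of_increment_le {φ : E → ℝ} {G p v : E} {a b : ℝ}
    (h : HasGradientAt φ G p)
    (hinc : ∀ t : ℝ, 0 < t → t < 1 → φ (p + t • v) - φ p ≤ t * (a + t * b)) :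
    ⟪G, v⟫ ≤ a := by
  have hd : HasDerivAt (fun s : ℝ => φ (p + s • v)) ⟪G, v⟫ 0 :=
    hasDerivAt_lineMap_of_hasGradientAt (by simpa using h)
  have h1 := hd.tendsto_slope_zero_right
  have h2 : Tendsto (fun t : ℝ => a + t * b) (𝓝[>] 0) (𝓝 a) := by
    have : Tendsto (fun t : ℝ => a + t * b) (𝓝 0) (𝓝 (a + 0 * b)) :=
      (Continuous.tendsto (by fun_prop) 0)
    simpa using this.mono_left nhdsWithin_le_nhds
  refine le_of_tendsto_of_tendsto h1 h2 ?_
  filter_upwards [Ioo_mem_nhdsGT (show (0 : ℝ) < 1 by norm_num)] with t ht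
  have := hinc t ht.1 ht.2
  simp only [zero_add, zero_smul, add_zero, smul_eq_mul]
  rw [inv_mul_le_iff₀ ht.1]
  exact this

/-- First order condition at a minimizer of a smooth plus a convex function. -/
theorem variational_inequality {s : Set E} {φ ψ : E → ℝ} {G p : E}
    (hφ : HasGradientAt φ G p) (hψ : ConvexOn ℝ s ψ) (hp : p ∈ s)
    (hmin : IsMinOn (fun z => φ z + ψ z) s p) {y : E} (hy : y ∈ s) :
    0 ≤ ⟪G, y - p⟫ + ψ y - ψ p := by
  have hneg : HasGradientAt (fun z => -φ z) (-G) p := by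
    rw [hasGradientAt_iff_hasFDerivAt] at hφ ⊢
    simpa using hφ.fun_neg
  -- Minimality bounds the decrease of `φ` by the convex increase of `ψ`, so the upper bound on
  -- increments is applied to `-φ`.
  have := inner_gradient_le_of_increment_le (v := y - p) (a := ψ y - ψ p) (b := 0) hneg (by
    intro t h0 h1
    have hcomb : p + t • (y - p) = (1 - t) • p + t • y := by module
    have hmem : p + t • (y - p) ∈ s := by
      rw [hcomb]; exact hψ.1 hp hy (by linarith) h0.le (by ring)
    have hm : φ p + ψ p ≤ φ (p + t • (y - p)) + ψ (p + t • (y - p)) := hmin hmem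
    have hc : ψ (p + t • (y - p)) ≤ (1 - t) * ψ p + t * ψ y := by
      rw [hcomb]; simpa using hψ.2 hp hy (by linarith : 0 ≤ 1 - t) h0.le (by ring)
    nlinarith)
  rw [inner_neg_left] at this
  linarith

/-- The defect `t (1 - t) c / 2 ‖z - w‖²` splits into a part linear in `t`, kept in the slope, and a
part in `t²`, which disappears in the limit. -/
theorem strongConvexOn_lower_bound {s : Set E} {φ : E → ℝ} {c : ℝ} {G w z : E}
    (hφ : StrongConvexOn s c φ) (hG : HasGradientAt φ G w) (hw : w ∈ s) (hz : z ∈ s) :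
    φ w + ⟪G, z - w⟫ + c / 2 * ‖z - w‖ ^ 2 ≤ φ z := by
  have := inner_gradient_le_of_increment_le (v := z - w)
    (a := φ z - φ w - c / 2 * ‖z - w‖ ^ 2) (b := c / 2 * ‖z - w‖ ^ 2) hG (by
    intro t h0 h1
    have hcomb : w + t • (z - w) = (1 - t) • w + t • z := by module
    have hc := hφ.2 hw hz (by linarith : 0 ≤ 1 - t) h0.le (by ring)
    rw [← hcomb, norm_sub_rev w z] at hc
    simp only [smul_eq_mul] at hc
    nlinarith)
  linarith

/-- Sum of the quadratic lower bounds taken at the two points. -/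
theorem strongConvexOn_monotone {s : Set E} {φ : E → ℝ} {c : ℝ} {G H w z : E}
    (hφ : StrongConvexOn s c φ) (hG : HasGradientAt φ G w) (hH : HasGradientAt φ H z)
    (hw : w ∈ s) (hz : z ∈ s) : c * ‖z - w‖ ^ 2 ≤ ⟪H - G, z - w⟫ := by
  have h1 := strongConvexOn_lower_bound hφ hG hw hz
  have h2 := strongConvexOn_lower_bound hφ hH hz hw
  rw [norm_sub_rev w z, ← neg_sub z w, inner_neg_right] at h2
  rw [inner_sub_left]
  linarith

/-- The quadratic upper bound along a segment on which the directional derivative is Lipschitz. -/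
theorem le_quadratic_of_lipschitz_directional {φ : E → ℝ} {G : E → E} {p v : E} {K : ℝ}
    (hG : ∀ t ∈ Set.Icc (0 : ℝ) 1, HasGradientAt φ (G (p + t • v)) (p + t • v))
    (hK : ∀ t ∈ Set.Icc (0 : ℝ) 1, ⟪G (p + t • v) - G p, v⟫ ≤ K * t) :
    φ (p + v) ≤ φ p + ⟪G p, v⟫ + K / 2 := by
  -- Once the linear and quadratic terms are subtracted, the function of `t` has nonpositive
  -- derivative.
  have hd : ∀ t ∈ Set.Icc (0 : ℝ) 1,
      HasDerivAt (fun t : ℝ => φ (p + t • v) - t * ⟪G p, v⟫ - K / 2 * t ^ 2)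
        (⟪G (p + t • v), v⟫ - ⟪G p, v⟫ - K * t) t := by
    intro t ht
    have h1 := hasDerivAt_lineMap_of_hasGradientAt (hG t ht)
    have h2 : HasDerivAt (fun t : ℝ => t * ⟪G p, v⟫) ⟪G p, v⟫ t := by
      simpa using (hasDerivAt_id t).mul_const ⟪G p, v⟫
    have h3 : HasDerivAt (fun t : ℝ => K / 2 * t ^ 2) (K * t) t := by
      exact ((hasDerivAt_pow 2 t).const_mul (K / 2)).congr_deriv (by norm_num; ring)
    exact (h1.sub h2).sub h3
  have hanti : AntitoneOn (fun t : ℝ => φ (p + t • v) - t * ⟪G p, v⟫ - K / 2 * t ^ 2)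
      (Set.Icc 0 1) := by
    refine antitoneOn_of_deriv_nonpos (convex_Icc 0 1)
      (fun t ht => (hd t ht).continuousAt.continuousWithinAt)
      (fun t ht => (hd t (interior_subset ht)).differentiableAt.differentiableWithinAt) ?_
    intro t ht
    rw [(hd t (interior_subset ht)).deriv]
    have := hK t (interior_subset ht)
    rw [inner_sub_left] at this
    linarith
  have := hanti (Set.left_mem_Icc.2 zero_le_one) (Set.right_mem_Icc.2 zero_le_one) zero_le_one
  simp only [one_smul, zero_smul, add_zero] at this
  linarith

end Calculus

/-- A function with quadratic growth attains its minimum on a closed set. -/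
theorem exists_isMinOn_of_quadratic_growth {E : Type*} [NormedAddCommGroup E]
    [NormedSpace ℝ E] [FiniteDimensional ℝ E] {s : Set E} {φ : E → ℝ}
    (hs : IsClosed s) (hφ : ContinuousOn φ s) {x : E} (hx : x ∈ s) {a b : ℝ} (hb : 0 < b)
    (hgrowth : ∀ z ∈ s, φ x - a * ‖z - x‖ + b * ‖z - x‖ ^ 2 ≤ φ z) :
    ∃ z ∈ s, IsMinOn φ s z := by
  -- Beyond the radius `|a| / b` the quadratic term outweighs the linear one, so no value there is
  -- below the value at `x`.
  have hcomp : IsCompact (s ∩ Metric.closedBall x (|a| / b)) :=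
    (isCompact_closedBall _ _).inter_left hs
  have hxm : x ∈ s ∩ Metric.closedBall x (|a| / b) :=
    ⟨hx, Metric.mem_closedBall_self (by positivity)⟩
  obtain ⟨z, hz, hmin⟩ := hcomp.exists_isMinOn ⟨x, hxm⟩ (hφ.mono Set.inter_subset_left)
  refine ⟨z, hz.1, fun w hw => ?_⟩
  by_cases hwb : w ∈ Metric.closedBall x (|a| / b)
  · exact hmin ⟨hw, hwb⟩
  · have h1 : |a| / b < ‖w - x‖ := by
      simpa [dist_eq_norm] using hwb
    rw [div_lt_iff₀ hb] at h1
    have h2 := hgrowth w hw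
    have h3 : φ z ≤ φ x := hmin hxm
    have h4 : 0 ≤ ‖w - x‖ := norm_nonneg _
    have h5 : a * ‖w - x‖ ≤ |a| * ‖w - x‖ := mul_le_mul_of_nonneg_right (le_abs_self a) h4
    have h6 : |a| * ‖w - x‖ ≤ (‖w - x‖ * b) * ‖w - x‖ := mul_le_mul_of_nonneg_right h1.le h4
    show φ z ≤ φ w
    nlinarith

/-! ### Scalar inequalities behind the complexity constants. -/

/-- `(a + L t)²` split with the weight that makes the `t`-part cost `2 L (u + L) t²`. -/
theorem add_sq_le_weighted {a b t L u : ℝ} (hL : 0 ≤ L) (hu : 0 < u) (ha : 0 ≤ a) (hb : 0 ≤ b)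
    (hbt : b ≤ L * t) :
    (a + b) ^ 2 ≤ (1 + L / (L + 2 * u)) * a ^ 2 + 2 * L * (u + L) * t ^ 2 := by
  have hD : 0 < L + 2 * u := by linarith
  have h1 : (a + b) ^ 2 ≤ (a + L * t) ^ 2 := by gcongr
  -- Young's inequality for `2 L a t`; with this weight the total coefficient of `t²` is `L² + L (L
  -- + 2 u) = 2 L (u + L)`.
  have h2 : 0 ≤ L / (L + 2 * u) * (a - (L + 2 * u) * t) ^ 2 := by positivity
  have h3 : L / (L + 2 * u) * (a - (L + 2 * u) * t) ^ 2
      = L / (L + 2 * u) * a ^ 2 - 2 * L * a * t + L * (L + 2 * u) * t ^ 2 := by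
    field_simp; ring
  nlinarith

/-- The two extreme cases, in the number of iterations, of `weight_bound`; here `p = γ L` and
`s = γ² L`. -/
theorem weight_bound_aux {L u p s : ℝ} {δ : ℕ} (hu : 0 < u) (hs : 0 ≤ s) (hp : 0 ≤ p) (hpL : p ≤ L)
    (hsL : s * L = p ^ 2) (h1 : 2 * p ≤ L + s) (h2 : 14 / 5 * p ≤ L + 2 * s)
    (hstep : p * (2 + (δ : ℝ) ^ 2) ≤ 2 * u) :
    (u + p * δ) ^ 2 ≤ (u + s) * (L + 2 * u) ∧
      (3 * L + 4 * u) * (u + p * δ) ^ 2 ≤ 2 * (u + L) * (2 * u + s) * (L + 2 * u) := by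
  have hL : 0 ≤ L := hp.trans hpL
  have e1 : (u + s) * (L + 2 * u) = u * L + 2 * u ^ 2 + p ^ 2 + 2 * u * s := by
    rw [← hsL]; ring
  have e2 : 2 * (u + L) * (2 * u + s) * (L + 2 * u)
      = 8 * u ^ 3 + 12 * u ^ 2 * L + 4 * u * L ^ 2 + 4 * s * u ^ 2 + 6 * u * p ^ 2
        + 2 * p ^ 2 * L := by
    rw [← hsL]; ring
  rw [e1, e2]
  -- After the expansion by `s L = p²`, the only terms still in `s` carry a factor `u` or `u²`;
  -- these two products bound them from below by monomials in `u`, `p` and `L`.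
  have k1 : u * (14 / 5 * p) ≤ u * (L + 2 * s) := mul_le_mul_of_nonneg_left h2 hu.le
  have k2 : u ^ 2 * (2 * p) ≤ u ^ 2 * (L + s) := mul_le_mul_of_nonneg_left h1 (by positivity)
  obtain ⟨m, hm, rfl⟩ : ∃ m, 0 ≤ m ∧ L = p + m := ⟨L - p, by linarith, by ring⟩
  by_cases hδ : 5 ≤ δ
  · have hδ' : (5 : ℝ) ≤ δ := by exact_mod_cast hδ
    have hr : p * δ ≤ 10 / 27 * u := by
      have : p * (27 * δ) ≤ p * (5 * (2 + (δ : ℝ) ^ 2)) :=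
        mul_le_mul_of_nonneg_left (by nlinarith) hp
      linarith
    have hr0 : 0 ≤ p * δ := by positivity
    have hsq : (u + p * δ) ^ 2 ≤ 19 / 10 * u ^ 2 := by
      have : (u + p * δ) ^ 2 ≤ (u + 10 / 27 * u) ^ 2 := by gcongr
      nlinarith [sq_nonneg u]
    constructor
    · have : 0 ≤ u * (p + m) + p ^ 2 + 2 * u * s := by positivity
      nlinarith [sq_nonneg u]
    · calc (3 * (p + m) + 4 * u) * (u + p * δ) ^ 2
          ≤ (3 * (p + m) + 4 * u) * (19 / 10 * u ^ 2) := by gcongr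
        _ ≤ 8 * u ^ 3 + 12 * u ^ 2 * (p + m) := by
            have : 0 ≤ u ^ 3 := by positivity
            have : 0 ≤ u ^ 2 * (p + m) := by positivity
            nlinarith
        _ ≤ _ := by
            have : 0 ≤ 4 * u * (p + m) ^ 2 + 4 * s * u ^ 2 + 6 * u * p ^ 2
              + 2 * p ^ 2 * (p + m) := by positivity
            linarith
  -- For the remaining delays put `u = K p + w` with `K = (2 + δ²) / 2`, the smallest value allowed
  -- by the step size. Together with `L = p + m` this makes each claim linear in nonnegative
  -- monomials.
  · have hcase : ∀ K : ℝ, p * K ≤ u → ∃ w, 0 ≤ w ∧ u = K * p + w :=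
      fun K h => ⟨u - K * p, by linarith, by ring⟩
    interval_cases δ
    · obtain ⟨w, hw, rfl⟩ := hcase 1 (by norm_num at hstep; linarith)
      norm_num
      constructor
      · have : 0 ≤ p ^ 2 ∧ 0 ≤ p * w ∧ 0 ≤ w ^ 2 := by refine ⟨?_, ?_, ?_⟩ <;> positivity
        linarith
      · have : 0 ≤ p ^ 3 ∧ 0 ≤ p ^ 2 * w ∧ 0 ≤ p * w ^ 2 ∧ 0 ≤ w ^ 3 ∧ 0 ≤ p ^ 2 * m ∧
            0 ≤ p * w * m ∧ 0 ≤ w ^ 2 * m ∧ 0 ≤ p * m ^ 2 ∧ 0 ≤ w * m ^ 2 := by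
          refine ⟨?_, ?_, ?_, ?_, ?_, ?_, ?_, ?_, ?_⟩ <;> positivity
        linarith
    · obtain ⟨w, hw, rfl⟩ := hcase (3 / 2) (by norm_num at hstep; linarith)
      norm_num
      constructor
      · have : 0 ≤ p ^ 2 ∧ 0 ≤ p * w ∧ 0 ≤ w ^ 2 := by refine ⟨?_, ?_, ?_⟩ <;> positivity
        linarith
      · have : 0 ≤ p ^ 3 ∧ 0 ≤ p ^ 2 * w ∧ 0 ≤ p * w ^ 2 ∧ 0 ≤ w ^ 3 ∧ 0 ≤ p ^ 2 * m ∧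
            0 ≤ p * w * m ∧ 0 ≤ w ^ 2 * m ∧ 0 ≤ p * m ^ 2 ∧ 0 ≤ w * m ^ 2 := by
          refine ⟨?_, ?_, ?_, ?_, ?_, ?_, ?_, ?_, ?_⟩ <;> positivity
        linarith
    · obtain ⟨w, hw, rfl⟩ := hcase 3 (by norm_num at hstep; linarith)
      norm_num
      constructor
      · have : 0 ≤ p ^ 2 ∧ 0 ≤ p * w ∧ 0 ≤ w ^ 2 := by refine ⟨?_, ?_, ?_⟩ <;> positivity
        linarith
      · have : 0 ≤ p ^ 3 ∧ 0 ≤ p ^ 2 * w ∧ 0 ≤ p * w ^ 2 ∧ 0 ≤ w ^ 3 ∧ 0 ≤ p ^ 2 * m ∧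
            0 ≤ p * w * m ∧ 0 ≤ w ^ 2 * m ∧ 0 ≤ p * m ^ 2 ∧ 0 ≤ w * m ^ 2 := by
          refine ⟨?_, ?_, ?_, ?_, ?_, ?_, ?_, ?_, ?_⟩ <;> positivity
        linarith
    · obtain ⟨w, hw, rfl⟩ := hcase (11 / 2) (by norm_num at hstep; linarith)
      norm_num
      constructor
      · have : 0 ≤ p ^ 2 ∧ 0 ≤ p * w ∧ 0 ≤ w ^ 2 := by refine ⟨?_, ?_, ?_⟩ <;> positivity
        linarith
      · have : 0 ≤ p ^ 3 ∧ 0 ≤ p ^ 2 * w ∧ 0 ≤ p * w ^ 2 ∧ 0 ≤ w ^ 3 ∧ 0 ≤ p ^ 2 * m ∧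
            0 ≤ p * w * m ∧ 0 ≤ w ^ 2 * m ∧ 0 ≤ p * m ^ 2 ∧ 0 ≤ w * m ^ 2 := by
          refine ⟨?_, ?_, ?_, ?_, ?_, ?_, ?_, ?_, ?_⟩ <;> positivity
        linarith
    · obtain ⟨w, hw, rfl⟩ := hcase 9 (by norm_num at hstep; linarith)
      norm_num
      constructor
      · have : 0 ≤ p ^ 2 ∧ 0 ≤ p * w ∧ 0 ≤ w ^ 2 := by refine ⟨?_, ?_, ?_⟩ <;> positivity
        linarith
      · have : 0 ≤ p ^ 3 ∧ 0 ≤ p ^ 2 * w ∧ 0 ≤ p * w ^ 2 ∧ 0 ≤ w ^ 3 ∧ 0 ≤ p ^ 2 * m ∧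
            0 ≤ p * w * m ∧ 0 ≤ w ^ 2 * m ∧ 0 ≤ p * m ^ 2 ∧ 0 ≤ w * m ^ 2 := by
          refine ⟨?_, ?_, ?_, ?_, ?_, ?_, ?_, ?_, ?_⟩ <;> positivity
        linarith

/-- With `r = γ L δ`: the numerical inequality behind the constants of the complexity bound. -/
theorem weight_bound {L u γ : ℝ} {δ T : ℕ} (hL : 0 ≤ L) (hu : 0 < u) (hγ0 : 0 < γ) (hγ1 : γ ≤ 1)
    (hT : 1 ≤ T) (hstep : γ * L * (2 + (δ : ℝ) ^ 2) ≤ 2 * u) :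
    ((T : ℝ) + 1 + T * (L / (L + 2 * u))) * (u + γ * L * δ) ^ 2
      ≤ 2 * (u * (u + L)) * (T + 1) + 2 * T * L * (u + L) * γ ^ 2 := by
  have hD : 0 < L + 2 * u := by linarith
  obtain ⟨h1, h2⟩ := weight_bound_aux (L := L) (p := γ * L) (s := γ ^ 2 * L) (δ := δ) hu
    (by positivity) (by positivity) (by nlinarith) (by ring)
    -- With `p = γ L` and `s = γ² L`, both side conditions are perfect squares times `L`: `(1 -
    -- γ)²`, and `(1 - 7/5 γ)²` using `49/25 ≤ 2`.
    (by nlinarith [mul_nonneg hL (sq_nonneg (1 - γ))])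
    (by nlinarith [mul_nonneg hL (sq_nonneg (1 - 7 / 5 * γ)), mul_nonneg hL (sq_nonneg γ)]) hstep
  have hT' : (0 : ℝ) ≤ (T : ℝ) - 1 := by
    have : (1 : ℝ) ≤ T := by exact_mod_cast hT
    linarith
  -- Both sides are affine in `T`, so it suffices to compare slopes and the values at `T = 1`.
  have e : ((T : ℝ) + 1 + T * (L / (L + 2 * u))) * (u + γ * L * δ) ^ 2 * (L + 2 * u)
      = (T - 1) * (2 * (L + u) * (u + γ * L * δ) ^ 2)
        + (3 * L + 4 * u) * (u + γ * L * δ) ^ 2 := by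
    field_simp; ring
  have k1 : ((T : ℝ) - 1) * (2 * (L + u) * (u + γ * L * δ) ^ 2)
      ≤ (T - 1) * (2 * (L + u) * ((u + γ ^ 2 * L) * (L + 2 * u))) := by
    gcongr
  refine le_of_mul_le_mul_right ?_ hD
  rw [e]
  nlinarith

end AsyFlexa

namespace AsyFlexa

/-! ### Block vectors and separable functions. -/

section Blocks

variable {N : ℕ} {n : Fin N → ℕ}

theorem norm_sq_eq_sum (x : Vec n) : ‖x‖ ^ 2 = ∑ i, ‖x i‖ ^ 2 :=
  PiLp.norm_sq_eq_of_L2 _ x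

theorem norm_block_le (x : Vec n) (i : Fin N) : ‖x i‖ ≤ ‖x‖ := by
  refine le_of_sq_le_sq ?_ (norm_nonneg x)
  rw [norm_sq_eq_sum]
  exact Finset.single_le_sum (f := fun i => ‖x i‖ ^ 2) (fun _ _ => sq_nonneg _) (Finset.mem_univ i)

theorem inner_eq_of_block {v : Vec n} {j : Fin N} (hv : ∀ i ≠ j, v i = 0) (w : Vec n) :
    ⟪w, v⟫ = ⟪w j, v j⟫ := by
  rw [PiLp.inner_apply]
  exact Finset.sum_eq_single j (fun i _ hi => by rw [hv i hi, inner_zero_right]) (by simp)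

theorem norm_eq_of_block {v : Vec n} {j : Fin N} (hv : ∀ i ≠ j, v i = 0) : ‖v‖ = ‖v j‖ := by
  have h : ‖v‖ ^ 2 = ‖v j‖ ^ 2 := by
    rw [norm_sq_eq_sum]
    exact Finset.sum_eq_single j (fun i _ hi => by rw [hv i hi]; simp) (by simp)
  exact (sq_eq_sq₀ (norm_nonneg _) (norm_nonneg _)).1 h

/-- `x` with its block `i` replaced by `z`. -/
def setBlock (x : Vec n) (i : Fin N) (z : EuclideanSpace ℝ (Fin (n i))) : Vec n :=
  WithLp.toLp 2 (Function.update (WithLp.ofLp x) i z)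

@[simp] theorem setBlock_same (x : Vec n) (i : Fin N) (z : EuclideanSpace ℝ (Fin (n i))) :
    setBlock x i z i = z := by
  simp [setBlock]

theorem setBlock_of_ne (x : Vec n) {i j : Fin N} (z : EuclideanSpace ℝ (Fin (n i))) (h : j ≠ i) :
    setBlock x i z j = x j := by
  simp [setBlock, h]

variable {X : ∀ i, Set (EuclideanSpace ℝ (Fin (n i)))}

theorem setBlock_mem {x : Vec n} (hx : x ∈ feasible X) {i : Fin N}
    {z : EuclideanSpace ℝ (Fin (n i))} (hz : z ∈ X i) : setBlock x i z ∈ feasible X := by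
  intro j
  by_cases h : j = i
  · subst h; simpa using hz
  · rw [setBlock_of_ne x z h]; exact hx j

theorem convex_feasible (h : ∀ i, Convex ℝ (X i)) : Convex ℝ (feasible X) := by
  intro x hx y hy a b ha hb hab i
  exact h i (hx i) (hy i) ha hb hab

theorem isClosed_feasible (h : ∀ i, IsClosed (X i)) : IsClosed (feasible X) := by
  have : feasible X = ⋂ i, (fun x : Vec n => x i) ⁻¹' X i := by
    ext x; simp [feasible]
  rw [this]
  exact isClosed_iInter fun i => (h i).preimage (by fun_prop)

variable {g : ∀ i, EuclideanSpace ℝ (Fin (n i)) → ℝ}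

theorem sepSum_setBlock_sub (x : Vec n) (i : Fin N) (z : EuclideanSpace ℝ (Fin (n i))) :
    sepSum g (setBlock x i z) - sepSum g x = g i z - g i (x i) := by
  unfold sepSum
  rw [← Finset.sum_sub_distrib, Finset.sum_eq_single i]
  · simp
  · intro j _ hj; rw [setBlock_of_ne x z hj]; simp
  · simp

theorem convexOn_sepSum (hX : ∀ i, Convex ℝ (X i)) (h : ∀ i, ConvexOn ℝ (X i) (g i)) :
    ConvexOn ℝ (feasible X) (sepSum g) := by
  refine ⟨convex_feasible hX, fun x hx y hy a b ha hb hab => ?_⟩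
  simp only [sepSum, smul_eq_mul, Finset.mul_sum, ← Finset.sum_add_distrib]
  exact Finset.sum_le_sum fun i _ => (h i).2 (hx i) (hy i) ha hb hab

theorem abs_sepSum_sub_le {Lg : ℝ≥0} (h : ∀ i, LipschitzOnWith Lg (g i) (X i)) {x y : Vec n}
    (hx : x ∈ feasible X) (hy : y ∈ feasible X) :
    |sepSum g y - sepSum g x| ≤ N * Lg * ‖y - x‖ := by
  unfold sepSum
  rw [← Finset.sum_sub_distrib]
  calc |∑ i, (g i (y i) - g i (x i))| ≤ ∑ i, |g i (y i) - g i (x i)| :=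
        Finset.abs_sum_le_sum_abs _ _
    _ ≤ ∑ _i : Fin N, Lg * ‖y - x‖ := by
        refine Finset.sum_le_sum fun i _ => ?_
        have h1 := (h i).dist_le_mul _ (hy i) _ (hx i)
        rw [Real.dist_eq, dist_eq_norm] at h1
        refine h1.trans (mul_le_mul_of_nonneg_left ?_ Lg.2)
        simpa using norm_block_le (y - x) i
    _ = N * Lg * ‖y - x‖ := by simp; ring

end Blocks

/-! ### The objective, the proximal map and its dependence on single blocks. -/

section Problem

variable {N : ℕ} {n : Fin N → ℕ} {X : ∀ i, Set (EuclideanSpace ℝ (Fin (n i)))}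
  {O : Set (Vec n)} {f : Vec n → ℝ} {g : ∀ i, EuclideanSpace ℝ (Fin (n i)) → ℝ} {Lf Lg : ℝ≥0}

theorem AssumptionA.hasGradientAt (hA : AssumptionA X O f g Lf Lg) {x : Vec n}
    (hx : x ∈ feasible X) : HasGradientAt f (gradient f x) x :=
  ((hA.smooth.differentiableOn one_ne_zero).differentiableAt
    (hA.isOpen.mem_nhds (hA.subset hx))).hasGradientAt

theorem AssumptionA.continuousOn_gradient (hA : AssumptionA X O f g Lf Lg) :
    ContinuousOn (gradient f) (feasible X) := by
  have h : ContinuousOn (fderiv ℝ f) O := hA.smooth.continuousOn_fderiv_of_isOpen hA.isOpen le_rfl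
  exact ((InnerProductSpace.toDual ℝ (Vec n)).symm.continuous.comp_continuousOn h).mono hA.subset

theorem AssumptionA.continuousOn_sepSum (hA : AssumptionA X O f g Lf Lg) :
    ContinuousOn (sepSum g) (feasible X) := by
  refine continuousOn_finsetSum _ fun i _ => ?_
  exact (hA.lipschitz_g i).continuousOn.comp (by fun_prop) fun x hx => hx i

theorem AssumptionA.continuousOn_objective (hA : AssumptionA X O f g Lf Lg) :
    ContinuousOn (objective f g) (feasible X) :=
  (hA.smooth.continuousOn.mono hA.subset).add hA.continuousOn_sepSum

/-- Coercivity handles the outside of a ball, compactness the inside. -/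
theorem AssumptionA.bddBelow_objective (hA : AssumptionA X O f g Lf Lg) :
    BddBelow (objective f g '' feasible X) := by
  have h := hA.coercive.eventually_ge_atTop 0
  rw [eventually_inf_principal] at h
  obtain ⟨r, hr⟩ := (Metric.hasBasis_cobounded_compl_closedBall (0 : Vec n)).eventually_iff.1 h
  have hcomp : IsCompact (feasible X ∩ Metric.closedBall (0 : Vec n) r) :=
    (isCompact_closedBall _ _).inter_left (isClosed_feasible hA.isClosed)
  obtain ⟨b, hb⟩ :=
    (hcomp.image_of_continuousOn (hA.continuousOn_objective.mono Set.inter_subset_left)).bddBelow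
  refine ⟨min b 0, ?_⟩
  rintro _ ⟨x, hx, rfl⟩
  by_cases hxr : x ∈ Metric.closedBall (0 : Vec n) r
  · exact (min_le_left _ _).trans (hb ⟨x, ⟨hx, hxr⟩, rfl⟩)
  · exact (min_le_right _ _).trans (hr.2 hxr hx)

theorem AssumptionA.sInf_le_objective (hA : AssumptionA X O f g Lf Lg) {x : Vec n}
    (hx : x ∈ feasible X) : sInf (objective f g '' feasible X) ≤ objective f g x :=
  csInf_le hA.bddBelow_objective ⟨x, hx, rfl⟩

/-- Block descent lemma. -/
theorem AssumptionA.descent (hA : AssumptionA X O f g Lf Lg) {x : Vec n} (hx : x ∈ feasible X)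
    {v : Vec n} {j : Fin N} (hv : ∀ i ≠ j, v i = 0) (hxv : x + v ∈ feasible X) :
    f (x + v) ≤ f x + ⟪blockGrad f j x, v j⟫ + Lf / 2 * ‖v j‖ ^ 2 := by
  have hmem : ∀ t ∈ Set.Icc (0 : ℝ) 1, x + t • v ∈ feasible X := by
    intro t ht
    have : x + t • v = (1 - t) • x + t • (x + v) := by module
    rw [this]
    exact convex_feasible hA.convex hx hxv (by linarith [ht.2]) ht.1 (by ring)
  have := le_quadratic_of_lipschitz_directional (φ := f) (G := gradient f) (p := x) (v := v)
    (K := Lf * ‖v j‖ ^ 2) (fun t ht => hA.hasGradientAt (hmem t ht)) (by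
      intro t ht
      rw [inner_eq_of_block hv]
      have h1 := (hA.lipschitz_grad j).dist_le_mul _ (hmem t ht) _ hx
      rw [dist_eq_norm, dist_eq_norm, add_sub_cancel_left, norm_smul, norm_eq_of_block hv,
        Real.norm_of_nonneg ht.1] at h1
      calc ⟪(gradient f (x + t • v) - gradient f x) j, v j⟫
          ≤ ‖blockGrad f j (x + t • v) - blockGrad f j x‖ * ‖v j‖ := real_inner_le_norm _ _
        _ ≤ Lf * (t * ‖v j‖) * ‖v j‖ := by gcongr
        _ = Lf * ‖v j‖ ^ 2 * t := by ring)
  rw [inner_eq_of_block hv] at this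
  unfold blockGrad
  linarith

theorem argmin_spec {E : Type*} [Nonempty E] {s : Set E} {φ : E → ℝ}
    (h : ∃ z ∈ s, IsMinOn φ s z) : argmin s φ ∈ s ∧ IsMinOn φ s (argmin s φ) :=
  Classical.epsilon_spec (p := fun z => z ∈ s ∧ IsMinOn φ s z) h

/-- The point `x - M_F(x)`: the proximal gradient step from `x`. -/
noncomputable def proxStep (X : ∀ i, Set (EuclideanSpace ℝ (Fin (n i)))) (f : Vec n → ℝ)
    (g : ∀ i, EuclideanSpace ℝ (Fin (n i)) → ℝ) (x : Vec n) : Vec n :=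
  argmin (feasible X) (fun y => ⟪gradient f x, y - x⟫ + sepSum g y + 1 / 2 * ‖y - x‖ ^ 2)

theorem statMap_eq (x : Vec n) : statMap X f g x = x - proxStep X f g x := rfl

/-- The inner product and the Lipschitz function `g` decrease at most linearly, so the quadratic
term gives the growth needed for existence. -/
theorem AssumptionA.proxStep_spec (hA : AssumptionA X O f g Lf Lg) {x : Vec n}
    (hx : x ∈ feasible X) :
    proxStep X f g x ∈ feasible X ∧
      IsMinOn (fun y => ⟪gradient f x, y - x⟫ + sepSum g y + 1 / 2 * ‖y - x‖ ^ 2) (feasible X)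
        (proxStep X f g x) := by
  refine argmin_spec (exists_isMinOn_of_quadratic_growth (isClosed_feasible hA.isClosed) ?_ hx
    (a := ‖gradient f x‖ + N * Lg) (b := 1 / 2) (by norm_num) ?_)
  · exact ((Continuous.continuousOn (by fun_prop)).add hA.continuousOn_sepSum).add
      (Continuous.continuousOn (by fun_prop))
  · intro z hz
    have h1 := (abs_le.1 (abs_real_inner_le_norm (gradient f x) (z - x))).1
    have h2 := (abs_le.1 (abs_sepSum_sub_le hA.lipschitz_g hx hz)).1
    simp only [sub_self, inner_zero_right, norm_zero]
    nlinarith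

theorem AssumptionA.proxStep_mem (hA : AssumptionA X O f g Lf Lg) {x : Vec n}
    (hx : x ∈ feasible X) : proxStep X f g x ∈ feasible X := (hA.proxStep_spec hx).1

theorem AssumptionA.proxStep_variational (hA : AssumptionA X O f g Lf Lg) {x y : Vec n}
    (hx : x ∈ feasible X) (hy : y ∈ feasible X) :
    0 ≤ ⟪gradient f x + (proxStep X f g x - x), y - proxStep X f g x⟫
      + sepSum g y - sepSum g (proxStep X f g x) := by
  obtain ⟨hp, hmin⟩ := hA.proxStep_spec hx
  refine variational_inequality (φ := fun y => ⟪gradient f x, y - x⟫ + 1 / 2 * ‖y - x‖ ^ 2)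
    ?_ (convexOn_sepSum hA.convex hA.convex_g) hp ?_ hy
  · rw [hasGradientAt_iff_hasFDerivAt]
    have h0 : HasFDerivAt (fun y : Vec n => y - x) (ContinuousLinearMap.id ℝ (Vec n))
      (proxStep X f g x) := (hasFDerivAt_id _).sub_const x
    have h1 := ((innerSL ℝ (gradient f x)).hasFDerivAt (x := proxStep X f g x - x)).comp
      (proxStep X f g x) h0
    have h2 := (h0.norm_sq).const_mul (1 / 2 : ℝ)
    refine (h1.add h2).congr_fderiv ?_
    ext v
    simp
  · intro z hz
    have := hmin hz
    simp only [Set.mem_ofPred_eq] at this ⊢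
    linarith

/-- The proximal problem separates over blocks: the test point differs from the proximal point only
in block `i`. -/
theorem AssumptionA.proxStep_variational_block (hA : AssumptionA X O f g Lf Lg) {x : Vec n}
    (hx : x ∈ feasible X) (i : Fin N) {z : EuclideanSpace ℝ (Fin (n i))} (hz : z ∈ X i) :
    0 ≤ ⟪blockGrad f i x + (proxStep X f g x i - x i), z - proxStep X f g x i⟫
      + g i z - g i (proxStep X f g x i) := by
  have h := hA.proxStep_variational hx (setBlock_mem (hA.proxStep_mem hx) hz)
  have h1 := sepSum_setBlock_sub (g := g) (proxStep X f g x) i z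
  rw [inner_eq_of_block (j := i)] at h
  · simp only [PiLp.add_apply, PiLp.sub_apply, setBlock_same] at h
    unfold blockGrad
    linarith
  · intro j hj
    rw [PiLp.sub_apply, setBlock_of_ne _ _ hj, sub_self]

theorem AssumptionA.isStationary_of_statMap_eq_zero (hA : AssumptionA X O f g Lf Lg) {x : Vec n}
    (hx : x ∈ feasible X) (h : statMap X f g x = 0) : IsStationary X f g x := by
  have hp : proxStep X f g x = x := by
    rw [statMap_eq, sub_eq_zero] at h; exact h.symm
  refine ⟨hx, fun y hy => ?_⟩
  have := hA.proxStep_variational hx hy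
  rwa [hp, sub_self, add_zero] at this

/-- Testing the variational inequality at each point with the proximal point of the other shows that
the proximal point moves no more than the point and its gradient together. -/
theorem AssumptionA.continuousOn_statMap (hA : AssumptionA X O f g Lf Lg) :
    ContinuousOn (statMap X f g) (feasible X) := by
  have key : ∀ x ∈ feasible X, ∀ y ∈ feasible X,
      ‖proxStep X f g y - proxStep X f g x‖ ≤ ‖gradient f y - gradient f x‖ + ‖y - x‖ := by
    intro x hx y hy
    have h1 := hA.proxStep_variational hx (hA.proxStep_mem hy)
    have h2 := hA.proxStep_variational hy (hA.proxStep_mem hx)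
    set p := proxStep X f g x
    set q := proxStep X f g y
    have h3 : ‖q - p‖ ^ 2 ≤ ⟪(gradient f x - gradient f y) + (y - x), q - p⟫ := by
      rw [← real_inner_self_eq_norm_sq]
      rw [← neg_sub q p, inner_neg_right] at h2
      simp only [inner_add_left, inner_sub_left] at *
      linarith
    have h4 : ⟪(gradient f x - gradient f y) + (y - x), q - p⟫
        ≤ (‖gradient f y - gradient f x‖ + ‖y - x‖) * ‖q - p‖ := by
      refine (real_inner_le_norm _ _).trans (mul_le_mul_of_nonneg_right ?_ (norm_nonneg _))
      exact (norm_add_le _ _).trans (by rw [norm_sub_rev (gradient f x)])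
    by_contra hcon
    push Not at hcon
    have h0 : 0 < ‖q - p‖ := lt_of_le_of_lt (by positivity) hcon
    nlinarith
  refine continuousOn_id.sub fun x hx => ?_
  have h1 : Tendsto (fun y => ‖gradient f y - gradient f x‖ + ‖y - x‖) (𝓝[feasible X] x) (𝓝 0) := by
    have ha : Tendsto (fun y => ‖gradient f y - gradient f x‖) (𝓝[feasible X] x) (𝓝 0) :=
      tendsto_iff_norm_sub_tendsto_zero.1 (hA.continuousOn_gradient x hx)
    have hb : Tendsto (fun y => ‖y - x‖) (𝓝[feasible X] x) (𝓝 0) :=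
      tendsto_iff_norm_sub_tendsto_zero.1 (continuousWithinAt_id (s := feasible X) (x := x))
    simpa using ha.add hb
  refine tendsto_iff_norm_sub_tendsto_zero.2 (squeeze_zero' (Eventually.of_forall fun _ =>
    norm_nonneg _) ?_ h1)
  filter_upwards [self_mem_nhdsWithin] with y hy using key x hx y hy

/-- The off-diagonal parts of the gradient are jointly Lipschitz with respect to a single block,
with the constant with which the gradient in that block is Lipschitz in the other blocks. -/
theorem AssumptionA.inner_gradient_sub_le (hA : AssumptionA X O f g Lf Lg) {j : Fin N} {L : ℝ}
    (hL0 : 0 ≤ L)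
    (hL : ∀ x ∈ feasible X, ∀ y ∈ feasible X, x j = y j →
      ‖blockGrad f j x - blockGrad f j y‖ ≤ L * ‖x - y‖)
    {x h z w : Vec n} (hx : x ∈ feasible X) (hh : ∀ i ≠ j, h i = 0) (hxh : x + h ∈ feasible X)
    (hz : z ∈ feasible X) (hw : w ∈ feasible X) (hzj : z j = x j) (hwj : w j = x j) :
    |⟪gradient f (x + h) - gradient f x, z - w⟫| ≤ L * ‖h‖ * ‖z - w‖ := by
  -- No second derivative is available, so symmetry is used in the form of the mixed second
  -- difference in the directions `h` and `v`. It is estimated along `h`, where only block `j` of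
  -- the gradient enters, and then differentiated along `v`. Since `x ± s v` may be infeasible, the
  -- differentiation takes place at `(1 - θ) x + (θ / 2)(z + w)`, and `θ → 0` at the end.
  set v := z - w with hv
  have hvj : v j = 0 := by simp [hv, hzj, hwj]
  have hconv := convex_feasible hA.convex
  -- second differences
  have second : ∀ p q : Vec n, p ∈ feasible X → q ∈ feasible X → p + h ∈ feasible X →
      q + h ∈ feasible X → p j = q j →
      |(f (q + h) - f (p + h)) - (f q - f p)| ≤ L * ‖h‖ * ‖q - p‖ := by
    intro p q hp hq hph hqh hpq
    have hm : ∀ a : Vec n, a ∈ feasible X → a + h ∈ feasible X →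
        ∀ t ∈ Set.Icc (0 : ℝ) 1, a + t • h ∈ feasible X := by
      intro a ha hah t ht
      have : a + t • h = (1 - t) • a + t • (a + h) := by module
      rw [this]
      exact hconv ha hah (by linarith [ht.2]) ht.1 (by ring)
    -- Mean value inequality in the direction `h`: the two moving points agree in block `j`, so the
    -- hypothesis on block `j` of the gradient bounds the derivative.
    have := norm_image_sub_le_of_norm_deriv_le_segment_01'
      (f := fun t : ℝ => f (q + t • h) - f (p + t • h))
      (f' := fun t => ⟪gradient f (q + t • h), h⟫ - ⟪gradient f (p + t • h), h⟫)
      (C := L * ‖h‖ * ‖q - p‖)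
      (fun t ht => ((hasDerivAt_lineMap_of_hasGradientAt (hA.hasGradientAt (hm q hq hqh t ht))).sub
        (hasDerivAt_lineMap_of_hasGradientAt
          (hA.hasGradientAt (hm p hp hph t ht)))).hasDerivWithinAt) (by
        intro t ht
        have ht' : t ∈ Set.Icc (0 : ℝ) 1 := ⟨ht.1, ht.2.le⟩
        rw [← inner_sub_left, inner_eq_of_block hh, norm_eq_of_block hh, Real.norm_eq_abs]
        refine (abs_real_inner_le_norm _ _).trans ?_
        have h1 := hL _ (hm q hq hqh t ht') _ (hm p hp hph t ht') (by simp [hpq])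
        rw [add_sub_add_right_eq_sub] at h1
        calc _ ≤ L * ‖q - p‖ * ‖h j‖ := mul_le_mul_of_nonneg_right h1 (norm_nonneg _)
          _ = _ := by ring)
    simpa [Real.norm_eq_abs] using this
  -- base points from which both directions `v` and `-v` are feasible
  have three : ∀ θ ∈ Set.Ioo (0 : ℝ) 1, ∀ s : ℝ, |s| < θ / 2 → ∀ y ∈ feasible X,
      (1 - θ) • y + (θ / 2 + s) • z + (θ / 2 - s) • w ∈ feasible X := by
    intro θ hθ s hs y hy
    rw [abs_lt] at hs
    simpa [Fin.sum_univ_three] using hconv.sum_mem (t := Finset.univ)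
      (w := ![1 - θ, θ / 2 + s, θ / 2 - s]) (z := ![y, z, w])
      (by intro k _; fin_cases k <;> simp <;> linarith [hθ.2])
      (by simp [Fin.sum_univ_three]; ring)
      (by intro k _; fin_cases k; exacts [hy, hz, hw])
  have hmem : ∀ θ ∈ Set.Ioo (0 : ℝ) 1, ∀ s : ℝ, |s| < θ / 2 →
      (1 - θ) • x + (θ / 2) • (z + w) + s • v ∈ feasible X ∧
        (1 - θ) • x + (θ / 2) • (z + w) + s • v + h ∈ feasible X := by
    intro θ hθ s hs
    have e : (1 - θ) • x + (θ / 2) • (z + w) + s • v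
        = (1 - θ) • x + (θ / 2 + s) • z + (θ / 2 - s) • w := by
      rw [hv]; module
    rw [e]
    -- Feasibility after adding `h` is checked blockwise: block `j` is that of `x + h`, the other
    -- blocks are unaffected by `h`.
    refine ⟨three θ hθ s hs x hx, fun i => ?_⟩
    by_cases hi : i = j
    · subst hi
      have : ((1 - θ) • x + (θ / 2 + s) • z + (θ / 2 - s) • w + h) i = (x + h) i := by
        simp only [PiLp.add_apply, PiLp.smul_apply, hzj, hwj]
        module
      rw [this]; exact hxh i
    · have := three θ hθ s hs x hx i
      simpa [hh i hi] using this
  have hmem0 : ∀ θ ∈ Set.Ioo (0 : ℝ) 1, (1 - θ) • x + (θ / 2) • (z + w) ∈ feasible X ∧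
      (1 - θ) • x + (θ / 2) • (z + w) + h ∈ feasible X := by
    intro θ hθ
    simpa using hmem θ hθ 0 (by simpa using hθ.1)
  have interior : ∀ θ ∈ Set.Ioo (0 : ℝ) 1,
      |⟪gradient f ((1 - θ) • x + (θ / 2) • (z + w) + h)
        - gradient f ((1 - θ) • x + (θ / 2) • (z + w)), v⟫| ≤ L * ‖h‖ * ‖v‖ := by
    intro θ hθ
    have hp0 := hmem0 θ hθ
    have hmem := hmem θ hθ
    set p := (1 - θ) • x + (θ / 2) • (z + w) with hpdef
    have hpos : 0 < θ / 2 := by linarith [hθ.1]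
    have hd : HasDerivAt (fun s : ℝ => f (p + h + s • v) - f (p + s • v))
        (⟪gradient f (p + h), v⟫ - ⟪gradient f p, v⟫) 0 :=
      (hasDerivAt_lineMap_of_hasGradientAt
        (by rw [zero_smul, add_zero]; exact hA.hasGradientAt hp0.2)).sub
      (hasDerivAt_lineMap_of_hasGradientAt
        (by rw [zero_smul, add_zero]; exact hA.hasGradientAt hp0.1))
    have := hd.le_of_lip' (C := L * ‖h‖ * ‖v‖) (by positivity) (by
      filter_upwards [Metric.ball_mem_nhds (0 : ℝ) hpos] with s hs
      have hs' : |s| < θ / 2 := by simpa using hs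
      have h1 := second p (p + s • v) hp0.1 (hmem s hs').1 hp0.2 (hmem s hs').2 (by simp [hvj])
      rw [add_sub_cancel_left, norm_smul, add_right_comm p (s • v) h] at h1
      simp only [zero_smul, add_zero, sub_zero, Real.norm_eq_abs] at h1 ⊢
      calc |f (p + h + s • v) - f (p + s • v) - (f (p + h) - f p)|
          = |f (p + h + s • v) - f (p + h) - (f (p + s • v) - f p)| := by congr 1; ring
        _ ≤ _ := h1
        _ = _ := by ring)
    rwa [← inner_sub_left, Real.norm_eq_abs] at this
  have lim1 : Tendsto (fun θ : ℝ => gradient f ((1 - θ) • x + (θ / 2) • (z + w))) (𝓝[>] 0)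
      (𝓝 (gradient f x)) := by
    refine (hA.continuousOn_gradient x hx).tendsto.comp (tendsto_nhdsWithin_iff.2 ⟨?_, ?_⟩)
    · have : Tendsto (fun θ : ℝ => (1 - θ) • x + (θ / 2) • (z + w)) (𝓝 0)
          (𝓝 ((1 - (0 : ℝ)) • x + ((0 : ℝ) / 2) • (z + w))) :=
        Continuous.tendsto (by fun_prop) 0
      simpa using this.mono_left nhdsWithin_le_nhds
    · filter_upwards [Ioo_mem_nhdsGT (show (0 : ℝ) < 1 by norm_num)] with θ hθ
      exact (hmem0 θ hθ).1
  have lim2 : Tendsto (fun θ : ℝ => gradient f ((1 - θ) • x + (θ / 2) • (z + w) + h)) (𝓝[>] 0)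
      (𝓝 (gradient f (x + h))) := by
    refine (hA.continuousOn_gradient (x + h) hxh).tendsto.comp
      (tendsto_nhdsWithin_iff.2 ⟨?_, ?_⟩)
    · have : Tendsto (fun θ : ℝ => (1 - θ) • x + (θ / 2) • (z + w) + h) (𝓝 0)
          (𝓝 ((1 - (0 : ℝ)) • x + ((0 : ℝ) / 2) • (z + w) + h)) :=
        Continuous.tendsto (by fun_prop) 0
      simpa using this.mono_left nhdsWithin_le_nhds
    · filter_upwards [Ioo_mem_nhdsGT (show (0 : ℝ) < 1 by norm_num)] with θ hθ
      exact (hmem0 θ hθ).2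
  refine le_of_tendsto (((lim2.sub lim1).inner tendsto_const_nhds).abs) ?_
  filter_upwards [Ioo_mem_nhdsGT (show (0 : ℝ) < 1 by norm_num)] with θ hθ using interior θ hθ

/-- The blocks of `M_F` move little when another block of the point is changed. -/
theorem AssumptionA.sum_statMap_sub_le (hA : AssumptionA X O f g Lf Lg) {j : Fin N} {L : ℝ}
    (hL0 : 0 ≤ L)
    (hL : ∀ x ∈ feasible X, ∀ y ∈ feasible X, x j = y j →
      ‖blockGrad f j x - blockGrad f j y‖ ≤ L * ‖x - y‖)
    {x y : Vec n} (hx : x ∈ feasible X) (hy : y ∈ feasible X) (hxy : ∀ i ≠ j, y i = x i) :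
    ∑ i ∈ Finset.univ.erase j, ‖statMap X f g y i - statMap X f g x i‖ ^ 2
      ≤ L ^ 2 * ‖y - x‖ ^ 2 := by
  set p := proxStep X f g x with hp
  set q := proxStep X f g y with hq
  have hpm := hA.proxStep_mem hx
  have hqm := hA.proxStep_mem hy
  have e1 : ∀ i ∈ Finset.univ.erase j,
      ‖statMap X f g y i - statMap X f g x i‖ ^ 2 = ‖p i - q i‖ ^ 2 := by
    intro i hi
    have hij : i ≠ j := (Finset.mem_erase.1 hi).1
    simp only [statMap_eq, PiLp.sub_apply, ← hp, ← hq, hxy i hij, sub_sub_sub_cancel_left]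
  rw [Finset.sum_congr rfl e1]
  -- Freezing block `j` of both proximal points at `x j` removes that block from their difference
  -- and meets the requirements of `inner_gradient_sub_le`.
  set v := setBlock p j (x j) - setBlock q j (x j) with hv
  have hvj : v j = 0 := by simp [hv]
  have hvi : ∀ i ≠ j, v i = p i - q i := by
    intro i hi; simp [hv, setBlock_of_ne _ _ hi]
  have e2 : ∑ i ∈ Finset.univ.erase j, ‖p i - q i‖ ^ 2 = ‖v‖ ^ 2 := by
    rw [norm_sq_eq_sum, ← Finset.add_sum_erase _ _ (Finset.mem_univ j), hvj]
    simp only [norm_zero, ne_eq, OfNat.ofNat_ne_zero, not_false_eq_true, zero_pow, zero_add]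
    exact Finset.sum_congr rfl fun i hi => by rw [hvi i (Finset.mem_erase.1 hi).1]
  -- In each block `i ≠ j` the variational inequalities at `x` and `y` are tested with each other;
  -- the terms in `x i = y i` cancel.
  have h1 : ‖v‖ ^ 2 ≤ ⟪gradient f y - gradient f x, v⟫ := by
    rw [← e2, PiLp.inner_apply, ← Finset.add_sum_erase _ _ (Finset.mem_univ j), hvj,
      inner_zero_right, zero_add]
    refine Finset.sum_le_sum fun i hi => ?_
    have hij : i ≠ j := (Finset.mem_erase.1 hi).1
    rw [hvi i hij]
    have h2 := hA.proxStep_variational_block hx i (hqm i)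
    have h3 := hA.proxStep_variational_block hy i (hpm i)
    rw [← hp, ← hq] at h2 h3
    rw [hxy i hij] at h3
    rw [← neg_sub (p i) (q i), inner_neg_right] at h2
    rw [← real_inner_self_eq_norm_sq]
    unfold blockGrad at h2 h3
    simp only [PiLp.sub_apply, inner_add_left, inner_sub_left] at *
    linarith
  have h2 := hA.inner_gradient_sub_le hL0 hL (x := x) (h := y - x) hx
    (fun i hi => by simp [hxy i hi]) (by simpa using hy)
    (setBlock_mem hpm (hx j)) (setBlock_mem hqm (hx j)) (by simp) (by simp)
  rw [add_sub_cancel, ← hv] at h2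
  have h3 := (le_abs_self _).trans h2
  rw [e2, ← mul_pow]
  have h4 : ‖v‖ ≤ L * ‖y - x‖ := by
    by_contra hcon
    push Not at hcon
    have h0 : 0 < ‖v‖ := lt_of_le_of_lt (by positivity) hcon
    nlinarith
  gcongr

end Problem

end AsyFlexa

namespace AsyFlexa

/-! ### Surrogates and best responses. -/

section Surrogate

variable {N : ℕ} {n : Fin N → ℕ} {X : ∀ i, Set (EuclideanSpace ℝ (Fin (n i)))}
  {O : Set (Vec n)} {f : Vec n → ℝ} {g : ∀ i, EuclideanSpace ℝ (Fin (n i)) → ℝ} {Lf Lg : ℝ≥0}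
  {ft : ∀ i, EuclideanSpace ℝ (Fin (n i)) → Vec n → ℝ} {c : ℝ} {LB LE : ℝ≥0}

theorem AssumptionB.hasGradientAt (hB : AssumptionB X f ft c LB LE) {i : Fin N} {y : Vec n}
    (hy : y ∈ feasible X) {z : EuclideanSpace ℝ (Fin (n i))} (hz : z ∈ X i) :
    HasGradientAt (fun w => ft i w y) (gradient (fun w => ft i w y) z) z := by
  obtain ⟨U, hU, hXU, hsm⟩ := hB.smooth i y hy
  exact ((hsm.differentiableOn one_ne_zero).differentiableAt
    (hU.mem_nhds (hXU hz))).hasGradientAt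

/-- Strong convexity of the surrogate gives quadratic growth, which dominates the linear terms from
its gradient and from `g`. -/
theorem bestResponse_spec (hA : AssumptionA X O f g Lf Lg) (hB : AssumptionB X f ft c LB LE)
    (i : Fin N) {y : Vec n} (hy : y ∈ feasible X) :
    bestResponse X g ft i y ∈ X i ∧
      IsMinOn (fun z => ft i z y + g i z) (X i) (bestResponse X g ft i y) := by
  refine argmin_spec (exists_isMinOn_of_quadratic_growth (hA.isClosed i) ?_ (hy i)
    (a := ‖gradient (fun w => ft i w y) (y i)‖ + Lg) (b := c / 2) (by linarith [hB.c_pos]) ?_)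
  · exact ContinuousOn.add
      (fun z hz => (hB.hasGradientAt hy hz).differentiableAt.continuousAt.continuousWithinAt)
      (hA.lipschitz_g i).continuousOn
  · intro z hz
    have h0 := strongConvexOn_lower_bound (hB.strongConvex i y hy)
      (hB.hasGradientAt hy (hy i)) (hy i) hz
    have h1 := (abs_le.1 (abs_real_inner_le_norm (gradient (fun w => ft i w y) (y i)) (z - y i))).1
    have h2 := (hA.lipschitz_g i).dist_le_mul _ hz _ (hy i)
    rw [Real.dist_eq, dist_eq_norm] at h2
    have h3 := (abs_le.1 h2).1
    nlinarith

theorem bestResponse_mem (hA : AssumptionA X O f g Lf Lg) (hB : AssumptionB X f ft c LB LE)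
    (i : Fin N) {y : Vec n} (hy : y ∈ feasible X) : bestResponse X g ft i y ∈ X i :=
  (bestResponse_spec hA hB i hy).1

theorem bestResponse_variational (hA : AssumptionA X O f g Lf Lg)
    (hB : AssumptionB X f ft c LB LE) {i : Fin N} {y : Vec n} (hy : y ∈ feasible X)
    {z : EuclideanSpace ℝ (Fin (n i))} (hz : z ∈ X i) :
    0 ≤ ⟪gradient (fun w => ft i w y) (bestResponse X g ft i y), z - bestResponse X g ft i y⟫
      + g i z - g i (bestResponse X g ft i y) :=
  variational_inequality (hB.hasGradientAt hy (bestResponse_mem hA hB i hy)) (hA.convex_g i)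
    (bestResponse_mem hA hB i hy) (bestResponse_spec hA hB i hy).2 hz

/-- In the other blocks, each partial gradient is Lipschitz with the smaller of the constants of
the partial gradient and of the surrogate gradient. -/
theorem blockGrad_lipschitz (hA : AssumptionA X O f g Lf Lg) (hB : AssumptionB X f ft c LB LE)
    {j : Fin N} {x y : Vec n} (hx : x ∈ feasible X) (hy : y ∈ feasible X) (hxy : x j = y j) :
    ‖blockGrad f j x - blockGrad f j y‖ ≤ min (Lf : ℝ) LB * ‖x - y‖ := by
  rw [min_mul_of_nonneg _ _ (norm_nonneg _)]
  refine le_min ?_ ?_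
  · simpa [dist_eq_norm] using (hA.lipschitz_grad j).dist_le_mul _ hx _ hy
  -- Because the own blocks agree, both partial gradients are surrogate gradients at the same first
  -- argument.
  · have := (hB.lipschitz_base j (x j) (hx j)).dist_le_mul _ hx _ hy
    rw [← hB.grad_consistent j x hx, ← hB.grad_consistent j y hy, ← hxy]
    simpa [dist_eq_norm] using this

theorem surrogate_monotone (hA : AssumptionA X O f g Lf Lg) (hB : AssumptionB X f ft c LB LE)
    (i : Fin N) {y : Vec n} (hy : y ∈ feasible X) :
    c * ‖bestResponse X g ft i y - y i‖ ^ 2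
      ≤ ⟪gradient (fun w => ft i w y) (bestResponse X g ft i y) - blockGrad f i y,
          bestResponse X g ft i y - y i⟫ := by
  rw [← hB.grad_consistent i y hy]
  exact strongConvexOn_monotone (hB.strongConvex i y hy) (hB.hasGradientAt hy (hy i))
    (hB.hasGradientAt hy (bestResponse_mem hA hB i hy)) (hy i) (bestResponse_mem hA hB i hy)

theorem surrogate_lipschitz (hA : AssumptionA X O f g Lf Lg) (hB : AssumptionB X f ft c LB LE)
    (i : Fin N) {y : Vec n} (hy : y ∈ feasible X) :
    ‖gradient (fun w => ft i w y) (bestResponse X g ft i y) - blockGrad f i y‖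
      ≤ LE * ‖bestResponse X g ft i y - y i‖ := by
  rw [← hB.grad_consistent i y hy]
  simpa [dist_eq_norm] using
    (hB.lipschitz_arg i y hy).dist_le_mul _ (bestResponse_mem hA hB i hy) _ (hy i)

/-- Unless no block ever moves, the modulus of strong convexity is at most `L_E`. -/
theorem bestResponse_eq_of_lt (hA : AssumptionA X O f g Lf Lg) (hB : AssumptionB X f ft c LB LE)
    (hc : (LE : ℝ) < c) (i : Fin N) {y : Vec n} (hy : y ∈ feasible X) :
    bestResponse X g ft i y - y i = 0 := by
  have h1 := surrogate_monotone hA hB i hy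
  have h2 := (real_inner_le_norm _ _).trans (mul_le_mul_of_nonneg_right
    (surrogate_lipschitz hA hB i hy) (norm_nonneg (bestResponse X g ft i y - y i)))
  -- Strong monotonicity and Cauchy–Schwarz squeeze the same inner product between `c` and `L_E`
  -- times the squared distance.
  have h3 : (c - LE) * ‖bestResponse X g ft i y - y i‖ ^ 2 ≤ 0 := by nlinarith
  have h4 : ‖bestResponse X g ft i y - y i‖ ^ 2 ≤ 0 := by
    by_contra h
    push Not at h
    nlinarith
  exact norm_eq_zero.1 (pow_eq_zero_iff (two_ne_zero) |>.1 (le_antisymm h4 (sq_nonneg _)))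

/-- The best response is a descent direction. -/
theorem bestResponse_descent (hA : AssumptionA X O f g Lf Lg) (hB : AssumptionB X f ft c LB LE)
    (i : Fin N) {y : Vec n} (hy : y ∈ feasible X) :
    ⟪blockGrad f i y, bestResponse X g ft i y - y i⟫ + g i (bestResponse X g ft i y) - g i (y i)
      ≤ -(c * ‖bestResponse X g ft i y - y i‖ ^ 2) := by
  have h1 := surrogate_monotone hA hB i hy
  have h2 := bestResponse_variational hA hB hy (hy i)
  rw [← neg_sub (bestResponse X g ft i y) (y i), inner_neg_right] at h2
  rw [inner_sub_left] at h1
  linarith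

/-- The stationarity measure in block `i` is controlled by the length of the step towards the best
response and by the error of the gradient at the delayed point. -/
theorem statMap_block_le (hA : AssumptionA X O f g Lf Lg) (hB : AssumptionB X f ft c LB LE)
    {i : Fin N} {x y : Vec n} (hx : x ∈ feasible X) (hy : y ∈ feasible X) (hxy : y i = x i) :
    ‖statMap X f g x i‖ ^ 2
      ≤ (1 + LE) ^ 2 * ‖bestResponse X g ft i y - x i‖ ^ 2
        + 2 * (2 + LE) * (‖blockGrad f i y - blockGrad f i x‖ * ‖bestResponse X g ft i y - x i‖)
        + ‖blockGrad f i y - blockGrad f i x‖ ^ 2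
        - 2 * c * ‖bestResponse X g ft i y - x i‖ ^ 2 := by
  have h1 := surrogate_monotone hA hB i hy
  have h2 := surrogate_lipschitz hA hB i hy
  have h3 := bestResponse_variational hA hB hy (hA.proxStep_mem hx i)
  have h4 := hA.proxStep_variational_block hx i (bestResponse_mem hA hB i hy)
  rw [statMap_eq, PiLp.sub_apply]
  rw [hxy] at h1 h2
  set p := proxStep X f g x i
  set q := bestResponse X g ft i y
  set Q := gradient (fun w => ft i w y) q
  set Gx := blockGrad f i x
  set Gy := blockGrad f i y
  -- The variational inequalities of the best response and of the proximal point, each tested with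
  -- the other point, are added; the values of `g i` cancel.
  have hsum : ‖x i - p‖ ^ 2 + ⟪x i - p, (q - x i) + ((Q - Gy) + (Gy - Gx))⟫
      + ⟪Q - Gy, q - x i⟫ + ⟪Gy - Gx, q - x i⟫ ≤ 0 := by
    have e1 : q - p = (q - x i) + (x i - p) := by abel
    have e2 : p - q = -((q - x i) + (x i - p)) := by abel
    have e3 : p - x i = -(x i - p) := by abel
    have e4 : Q = (Q - Gy) + (Gy - Gx) + Gx := by abel
    rw [e2, e4] at h3
    rw [e1, e3] at h4
    simp only [inner_add_left, inner_add_right, inner_neg_left, inner_neg_right,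
      real_inner_self_eq_norm_sq] at h3 h4 ⊢
    have c1 := real_inner_comm (x i - p) (Q - Gy)
    have c2 := real_inner_comm (x i - p) (Gy - Gx)
    have c3 := real_inner_comm (x i - p) (q - x i)
    linarith
  have h5 : -⟪x i - p, (q - x i) + ((Q - Gy) + (Gy - Gx))⟫
      ≤ ‖x i - p‖ * ((1 + LE) * ‖q - x i‖ + ‖Gy - Gx‖) := by
    refine (neg_le_abs _).trans ((abs_real_inner_le_norm _ _).trans
      (mul_le_mul_of_nonneg_left ?_ (norm_nonneg _)))
    have := norm_add_le (q - x i) ((Q - Gy) + (Gy - Gx))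
    have := norm_add_le (Q - Gy) (Gy - Gx)
    linarith
  have h6 : -⟪Gy - Gx, q - x i⟫ ≤ ‖Gy - Gx‖ * ‖q - x i‖ :=
    (neg_le_abs _).trans (abs_real_inner_le_norm _ _)
  -- Young's inequality absorbs one of the two copies of `‖x i - p‖²`; monotonicity contributes the
  -- term `-2 c`.
  nlinarith [sq_nonneg (‖x i - p‖ - ((1 + LE) * ‖q - x i‖ + ‖Gy - Gx‖))]

end Surrogate

/-! ### Past steps and the memory term of the Lyapunov function. -/

section Lag

variable {E : Type*} [SeminormedAddCommGroup E]

/-- The squared length of the step of the sequence `x` made `m + 1` iterations before `k`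
(zero before the start). -/
def lagStep (x : ℕ → E) (k m : ℕ) : ℝ := ‖x (k - m) - x (k - (m + 1))‖ ^ 2

theorem lagStep_nonneg (x : ℕ → E) (k m : ℕ) : 0 ≤ lagStep x k m := sq_nonneg _

theorem lagStep_succ_succ (x : ℕ → E) (k m : ℕ) :
    lagStep x (k + 1) (m + 1) = lagStep x k m := by
  unfold lagStep
  congr 4 <;> omega

theorem lagStep_zero_left (x : ℕ → E) (m : ℕ) : lagStep x 0 m = 0 := by simp [lagStep]

theorem lagStep_succ_zero (x : ℕ → E) (k : ℕ) : lagStep x (k + 1) 0 = ‖x (k + 1) - x k‖ ^ 2 := by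
  simp [lagStep]

/-- For a fixed lag every step of the sequence is counted at most once, and indices before the start
contribute zero. -/
theorem sum_lagStep_le (x : ℕ → E) (S m : ℕ) :
    ∑ s ∈ Finset.range S, lagStep x s m ≤ ∑ l ∈ Finset.range S, ‖x (l + 1) - x l‖ ^ 2 := by
  induction m generalizing S with
  | zero =>
    cases S with
    | zero => simp
    | succ S =>
      rw [Finset.sum_range_succ', lagStep_zero_left, add_zero, Finset.sum_range_succ]
      simp only [lagStep_succ_zero]
      exact le_add_of_nonneg_right (sq_nonneg _)
  | succ m ih =>
    cases S with
    | zero => simp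
    | succ S =>
      rw [Finset.sum_range_succ', lagStep_zero_left, add_zero, Finset.sum_range_succ]
      simp only [lagStep_succ_succ]
      exact (ih S).trans (le_add_of_nonneg_right (sq_nonneg _))

theorem sum_sum_lagStep_le (x : ℕ → E) (S δ : ℕ) :
    ∑ s ∈ Finset.range S, ∑ m ∈ Finset.range δ, lagStep x s m
      ≤ δ * ∑ l ∈ Finset.range S, ‖x (l + 1) - x l‖ ^ 2 := by
  rw [Finset.sum_comm]
  calc _ ≤ ∑ _m ∈ Finset.range δ, ∑ l ∈ Finset.range S, ‖x (l + 1) - x l‖ ^ 2 :=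
        Finset.sum_le_sum fun m _ => sum_lagStep_le x S m
    _ = _ := by simp

theorem norm_sub_lag_le (x : ℕ → E) (k d : ℕ) :
    ‖x k - x (k - d)‖ ≤ ∑ m ∈ Finset.range d, ‖x (k - m) - x (k - (m + 1))‖ := by
  induction d with
  | zero => simp
  | succ d ih =>
    rw [Finset.sum_range_succ]
    exact (norm_sub_le_norm_sub_add_norm_sub _ (x (k - d)) _).trans (by gcongr)

theorem sq_norm_sub_lag_le (x : ℕ → E) (k : ℕ) {d δ : ℕ} (hd : d ≤ δ) :
    ‖x k - x (k - d)‖ ^ 2 ≤ δ * ∑ m ∈ Finset.range δ, lagStep x k m := by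
  calc ‖x k - x (k - d)‖ ^ 2
      ≤ (∑ m ∈ Finset.range δ, ‖x (k - m) - x (k - (m + 1))‖) ^ 2 := by
        gcongr
        exact (norm_sub_lag_le x k d).trans (Finset.sum_le_sum_of_subset_of_nonneg
          (Finset.range_mono hd) fun _ _ _ => norm_nonneg _)
    _ ≤ _ := by
        simpa [lagStep] using sq_sum_le_card_mul_sum_sq (s := Finset.range δ)
          (f := fun m => ‖x (k - m) - x (k - (m + 1))‖)

/-- The memory term of the Lyapunov function. -/
def memory (δ : ℕ) (x : ℕ → E) (k : ℕ) : ℝ :=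
  ∑ m ∈ Finset.range δ, ((δ : ℝ) - m) * lagStep x k m

theorem memory_nonneg (δ : ℕ) (x : ℕ → E) (k : ℕ) : 0 ≤ memory δ x k := by
  refine Finset.sum_nonneg fun m hm => mul_nonneg ?_ (lagStep_nonneg x k m)
  have : (m : ℝ) ≤ δ := by exact_mod_cast (Finset.mem_range.1 hm).le
  linarith

theorem memory_zero (δ : ℕ) (x : ℕ → E) : memory δ x 0 = 0 := by
  simp [memory, lagStep_zero_left]

/-- When time advances, each remembered step loses one unit of weight and the new step enters with
weight `δ`. The lost amount, times `δ`, is the bound on the squared delay error in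
`IsRun.delay_error_le`. -/
theorem memory_succ (δ : ℕ) (x : ℕ → E) (k : ℕ) :
    memory δ x (k + 1) = memory δ x k + δ * ‖x (k + 1) - x k‖ ^ 2
      - ∑ m ∈ Finset.range δ, lagStep x k m := by
  have h : memory δ x (k + 1)
      = ∑ m ∈ Finset.range (δ + 1), ((δ : ℝ) - m) * lagStep x (k + 1) m := by
    rw [Finset.sum_range_succ]; simp [memory]
  rw [h, Finset.sum_range_succ', lagStep_succ_zero]
  simp only [lagStep_succ_succ, Nat.cast_zero, sub_zero]
  have h2 : ∑ m ∈ Finset.range δ, ((δ : ℝ) - (m + 1 : ℕ)) * lagStep x k m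
      = memory δ x k - ∑ m ∈ Finset.range δ, lagStep x k m := by
    unfold memory
    rw [← Finset.sum_sub_distrib]
    refine Finset.sum_congr rfl fun m _ => ?_
    push_cast; ring
  rw [h2]; ring

end Lag

/-- Substitution `m = k - 1 - l`. Truncated subtraction matches `Int.toNat`: steps before the start
have length zero in both forms. -/
theorem lyapunov_eq {N : ℕ} {n : Fin N → ℕ} (F : Vec n → ℝ) (δ : ℕ) (Lf : ℝ) (x : ℕ → Vec n)
    (k : ℕ) : lyapunov F δ Lf x k = F (x k) + δ * (Lf / 2) * memory δ x k := by
  unfold lyapunov memory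
  congr 2
  refine Finset.sum_bij' (fun l _ => ((k : ℤ) - 1 - l).toNat) (fun m _ => (k : ℤ) - 1 - m)
    ?_ ?_ ?_ ?_ ?_
  · intro l hl
    simp only [Finset.mem_Ico, Finset.mem_range] at *
    omega
  · intro m hm
    simp only [Finset.mem_Ico, Finset.mem_range] at *
    omega
  · intro l hl
    simp only [Finset.mem_Ico] at *
    omega
  · intro m hm
    simp
  · intro l hl
    simp only [Finset.mem_Ico] at hl
    obtain ⟨m, rfl⟩ : ∃ m : ℕ, l = (k : ℤ) - 1 - m := ⟨((k : ℤ) - 1 - l).toNat, by omega⟩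
    have e0 : ((k : ℤ) - 1 - ((k : ℤ) - 1 - m)).toNat = m := by omega
    have e1 : ((k : ℤ) - 1 - m + 1).toNat = k - m := by omega
    have e2 : ((k : ℤ) - 1 - m).toNat = k - (m + 1) := by omega
    rw [e0, e1, e2]
    unfold lagStep
    push_cast
    ring

end AsyFlexa

/-! ### Deterministic runs: decrease of the Lyapunov function and updated blocks. -/

namespace AsyFlexa

variable {N : ℕ} {n : Fin N → ℕ} {X : ∀ i, Set (EuclideanSpace ℝ (Fin (n i)))}
  {O : Set (Vec n)} {f : Vec n → ℝ} {g : ∀ i, EuclideanSpace ℝ (Fin (n i)) → ℝ} {Lf Lg : ℝ≥0}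
  {ft : ∀ i, EuclideanSpace ℝ (Fin (n i)) → Vec n → ℝ} {c : ℝ} {LB LE : ℝ≥0} {γ : ℝ} {δ : ℕ}

/-- A deterministic run of the algorithm: `x` are the iterates, `b` the updated blocks and `y` the
delayed points, whose delays are at most `δ` and vanish in the updated block. -/
structure IsRun (X : ∀ i, Set (EuclideanSpace ℝ (Fin (n i))))
    (g : ∀ i, EuclideanSpace ℝ (Fin (n i)) → ℝ)
    (ft : ∀ i, EuclideanSpace ℝ (Fin (n i)) → Vec n → ℝ) (γ : ℝ) (δ : ℕ)
    (x : ℕ → Vec n) (b : ℕ → Fin N) (y : ℕ → Vec n) : Prop where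
  mem : ∀ k, x k ∈ feasible X
  mem_delayed : ∀ k, y k ∈ feasible X
  own : ∀ k, y k (b k) = x k (b k)
  delay : ∀ k j, ∃ d ≤ δ, y k j = x (k - d) j
  succ : ∀ k, x (k + 1) = step X g ft γ (b k) (x k) (y k)

/-- The squared distance of the updated block to its best response. -/
noncomputable def gapSq (X : ∀ i, Set (EuclideanSpace ℝ (Fin (n i))))
    (g : ∀ i, EuclideanSpace ℝ (Fin (n i)) → ℝ)
    (ft : ∀ i, EuclideanSpace ℝ (Fin (n i)) → Vec n → ℝ)
    (x : ℕ → Vec n) (b : ℕ → Fin N) (y : ℕ → Vec n) (k : ℕ) : ℝ :=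
  ‖bestResponse X g ft (b k) (y k) - x k (b k)‖ ^ 2

/-- The decrease of the Lyapunov function per unit of `gapSq`. -/
noncomputable def decreaseRate (γ c Lf : ℝ) (δ : ℕ) : ℝ := γ * (c - γ * (Lf + (δ : ℝ) ^ 2 * Lf / 2))

theorem step_eq (i : Fin N) (x y : Vec n) :
    step X g ft γ i x y = setBlock x i (x i + γ • (bestResponse X g ft i y - x i)) := rfl

namespace IsRun

variable {x : ℕ → Vec n} {b : ℕ → Fin N} {y : ℕ → Vec n}

theorem succ_of_ne (h : IsRun X g ft γ δ x b y) {k : ℕ} {i : Fin N} (hi : i ≠ b k) :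
    x (k + 1) i = x k i := by
  rw [h.succ, step_eq, setBlock_of_ne _ _ hi]

theorem succ_same (h : IsRun X g ft γ δ x b y) (k : ℕ) :
    x (k + 1) (b k) = x k (b k) + γ • (bestResponse X g ft (b k) (y k) - x k (b k)) := by
  rw [h.succ, step_eq, setBlock_same]

theorem sub_block (h : IsRun X g ft γ δ x b y) (k : ℕ) :
    ∀ i ≠ b k, (x (k + 1) - x k) i = 0 := fun i hi => by
  rw [PiLp.sub_apply, h.succ_of_ne hi, sub_self]

theorem sub_same (h : IsRun X g ft γ δ x b y) (k : ℕ) :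
    (x (k + 1) - x k) (b k) = γ • (bestResponse X g ft (b k) (y k) - x k (b k)) := by
  rw [PiLp.sub_apply, h.succ_same, add_sub_cancel_left]

theorem norm_sub_sq (h : IsRun X g ft γ δ x b y) (k : ℕ) :
    ‖x (k + 1) - x k‖ ^ 2 = γ ^ 2 * gapSq X g ft x b y k := by
  rw [norm_eq_of_block (h.sub_block k), h.sub_same, norm_smul, mul_pow, Real.norm_eq_abs, sq_abs]
  rfl

theorem gapSq_nonneg (x : ℕ → Vec n) (b : ℕ → Fin N) (y : ℕ → Vec n) (k : ℕ) :
    0 ≤ gapSq X g ft x b y k := sq_nonneg _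

/-- Each block has its own delay, so the telescoping and Cauchy–Schwarz are done blockwise; summing
the blocks reassembles full steps without a factor `N`. -/
theorem delay_error_le (h : IsRun X g ft γ δ x b y) (k : ℕ) :
    ‖x k - y k‖ ^ 2 ≤ δ * ∑ m ∈ Finset.range δ, lagStep x k m := by
  calc ‖x k - y k‖ ^ 2 = ∑ j, ‖x k j - y k j‖ ^ 2 := by
        rw [norm_sq_eq_sum]; simp
    _ ≤ ∑ j, δ * ∑ m ∈ Finset.range δ, lagStep (fun l => x l j) k m := by
        refine Finset.sum_le_sum fun j _ => ?_
        obtain ⟨d, hd, hy⟩ := h.delay k j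
        rw [hy]
        exact sq_norm_sub_lag_le (fun l => x l j) k hd
    _ = _ := by
        rw [← Finset.mul_sum, Finset.sum_comm]
        congr 1
        refine Finset.sum_congr rfl fun m _ => ?_
        unfold lagStep
        rw [norm_sq_eq_sum]
        simp

theorem sum_delay_error_le (h : IsRun X g ft γ δ x b y) (S : ℕ) :
    ∑ s ∈ Finset.range S, ‖x s - y s‖ ^ 2
      ≤ (γ * δ) ^ 2 * ∑ s ∈ Finset.range S, gapSq X g ft x b y s := by
  calc ∑ s ∈ Finset.range S, ‖x s - y s‖ ^ 2
      ≤ ∑ s ∈ Finset.range S, δ * ∑ m ∈ Finset.range δ, lagStep x s m :=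
        Finset.sum_le_sum fun s _ => h.delay_error_le s
    _ ≤ δ * (δ * ∑ l ∈ Finset.range S, ‖x (l + 1) - x l‖ ^ 2) := by
        rw [← Finset.mul_sum]
        exact mul_le_mul_of_nonneg_left (sum_sum_lagStep_le x S δ) (Nat.cast_nonneg δ)
    _ = _ := by
        simp only [h.norm_sub_sq, ← Finset.mul_sum]
        ring

/-- This is where the vanishing own-block delay is needed: it permits the smaller of the two
Lipschitz constants. -/
theorem gradient_error_le (h : IsRun X g ft γ δ x b y) (hA : AssumptionA X O f g Lf Lg)
    (hB : AssumptionB X f ft c LB LE) (k : ℕ) :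
    ‖blockGrad f (b k) (y k) - blockGrad f (b k) (x k)‖ ≤ min (Lf : ℝ) LB * ‖x k - y k‖ := by
  rw [norm_sub_rev]
  exact blockGrad_lipschitz hA hB (h.mem k) (h.mem_delayed k) (h.own k).symm

/-- The Lyapunov function decreases along a run. -/
theorem lyapunov_decrease (h : IsRun X g ft γ δ x b y) (hA : AssumptionA X O f g Lf Lg)
    (hB : AssumptionB X f ft c LB LE) (hγ0 : 0 < γ) (hγ1 : γ ≤ 1) (k : ℕ) :
    decreaseRate γ c Lf δ * gapSq X g ft x b y k
      ≤ lyapunov (objective f g) δ Lf x k - lyapunov (objective f g) δ Lf x (k + 1) := by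
  have h1 := hA.descent (h.mem k) (h.sub_block k) (by simpa using h.mem (k + 1))
  rw [add_sub_cancel, h.sub_same, inner_smul_right, norm_smul, Real.norm_of_nonneg hγ0.le] at h1
  have h2 := bestResponse_descent hA hB (b k) (h.mem_delayed k)
  have h3 := h.gradient_error_le hA hB k
  have h4 := h.delay_error_le k
  have h5 : sepSum g (x (k + 1)) - sepSum g (x k)
      ≤ γ * (g (b k) (bestResponse X g ft (b k) (y k)) - g (b k) (x k (b k))) := by
    rw [h.succ, step_eq, sepSum_setBlock_sub]
    have := (hA.convex_g (b k)).2 (h.mem k (b k))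
      (bestResponse_mem hA hB (b k) (h.mem_delayed k)) (by linarith : 0 ≤ 1 - γ) hγ0.le (by ring)
    have e : x k (b k) + γ • (bestResponse X g ft (b k) (y k) - x k (b k))
        = (1 - γ) • x k (b k) + γ • bestResponse X g ft (b k) (y k) := by module
    rw [e]
    simp only [smul_eq_mul] at this
    linarith
  rw [h.own] at h2
  have h6 : ⟪blockGrad f (b k) (x k), bestResponse X g ft (b k) (y k) - x k (b k)⟫
      ≤ ⟪blockGrad f (b k) (y k), bestResponse X g ft (b k) (y k) - x k (b k)⟫
        + Lf * ‖x k - y k‖ * ‖bestResponse X g ft (b k) (y k) - x k (b k)‖ := by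
    have e := real_inner_le_norm (blockGrad f (b k) (x k) - blockGrad f (b k) (y k))
      (bestResponse X g ft (b k) (y k) - x k (b k))
    rw [inner_sub_left, norm_sub_rev] at e
    have : ‖blockGrad f (b k) (y k) - blockGrad f (b k) (x k)‖ ≤ Lf * ‖x k - y k‖ :=
      h3.trans (mul_le_mul_of_nonneg_right (min_le_left _ _) (norm_nonneg _))
    have := mul_le_mul_of_nonneg_right this
      (norm_nonneg (bestResponse X g ft (b k) (y k) - x k (b k)))
    linarith
  rw [lyapunov_eq, lyapunov_eq, memory_succ, h.norm_sub_sq]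
  unfold decreaseRate gapSq objective
  set d := ‖bestResponse X g ft (b k) (y k) - x k (b k)‖
  set e := ‖x k - y k‖
  set I := ⟪blockGrad f (b k) (x k), bestResponse X g ft (b k) (y k) - x k (b k)⟫
  set J := ⟪blockGrad f (b k) (y k), bestResponse X g ft (b k) (y k) - x k (b k)⟫
  set W := ∑ m ∈ Finset.range δ, lagStep x k m
  have hLf : (0 : ℝ) ≤ Lf := Lf.2
  have h7 : γ * I ≤ γ * (J + Lf * e * d) := mul_le_mul_of_nonneg_left h6 hγ0.le
  have h8 : γ * (J + g (b k) (bestResponse X g ft (b k) (y k)) - g (b k) (x k (b k)))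
      ≤ γ * -(c * d ^ 2) := mul_le_mul_of_nonneg_left h2 hγ0.le
  -- The cross term costs `L_f / 2` times `(γ d)² + e²`. The `e²` part cancels against the weight
  -- lost by the memory, and the new step adds `δ² L_f / 2` to the coefficient of `(γ d)²`, which
  -- becomes `L_f + δ² L_f / 2`.
  have h9 : (Lf : ℝ) * (2 * (γ * d * e)) ≤ Lf * ((γ * d) ^ 2 + e ^ 2) :=
    mul_le_mul_of_nonneg_left (by nlinarith [sq_nonneg (γ * d - e)]) hLf
  have h10 : (Lf : ℝ) * e ^ 2 ≤ Lf * (δ * W) := mul_le_mul_of_nonneg_left h4 hLf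
  nlinarith

theorem objective_le_lyapunov (x : ℕ → Vec n) (k : ℕ) :
    objective f g (x k) ≤ lyapunov (objective f g) δ Lf x k := by
  rw [lyapunov_eq]
  have := memory_nonneg δ x k
  exact le_add_of_nonneg_right (by positivity)

/-- The decreases telescope; the memory is zero at the start and nonnegative later. -/
theorem sum_gapSq_le (h : IsRun X g ft γ δ x b y) (hA : AssumptionA X O f g Lf Lg)
    (hB : AssumptionB X f ft c LB LE) (hγ0 : 0 < γ) (hγ1 : γ ≤ 1) (S : ℕ) :
    decreaseRate γ c Lf δ * ∑ s ∈ Finset.range S, gapSq X g ft x b y s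
      ≤ objective f g (x 0) - sInf (objective f g '' feasible X) := by
  rw [Finset.mul_sum]
  calc _ ≤ ∑ s ∈ Finset.range S, (lyapunov (objective f g) δ Lf x s
        - lyapunov (objective f g) δ Lf x (s + 1)) :=
        Finset.sum_le_sum fun s _ => h.lyapunov_decrease hA hB hγ0 hγ1 s
    _ = lyapunov (objective f g) δ Lf x 0 - lyapunov (objective f g) δ Lf x S :=
        Finset.sum_range_sub' _ S
    _ ≤ _ := by
        have h1 : lyapunov (objective f g) δ Lf x 0 = objective f g (x 0) := by
          rw [lyapunov_eq, memory_zero, mul_zero, add_zero]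
        rw [h1]
        exact sub_le_sub_left ((hA.sInf_le_objective (h.mem S)).trans
          (objective_le_lyapunov x S)) _

/-- The Lyapunov function is monotone and bounded below; it differs from `F` by the memory term,
which tends to zero because the steps do. -/
theorem tendsto_objective (h : IsRun X g ft γ δ x b y) (hA : AssumptionA X O f g Lf Lg)
    (hB : AssumptionB X f ft c LB LE) (hγ0 : 0 < γ) (hγ1 : γ ≤ 1)
    (hrate : 0 < decreaseRate γ c Lf δ) :
    ∃ v : ℝ, Tendsto (fun k => objective f g (x k)) atTop (𝓝 v) := by
  have hgap : Summable (gapSq X g ft x b y) := by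
    refine summable_of_sum_range_le
      (c := (objective f g (x 0) - sInf (objective f g '' feasible X)) / decreaseRate γ c Lf δ)
      (fun k => gapSq_nonneg x b y k) fun S => ?_
    rw [le_div_iff₀ hrate, mul_comm]
    exact h.sum_gapSq_le hA hB hγ0 hγ1 S
  have hstep : Tendsto (fun k => ‖x (k + 1) - x k‖ ^ 2) atTop (𝓝 0) := by
    simp only [h.norm_sub_sq]
    simpa using hgap.tendsto_atTop_zero.const_mul (γ ^ 2)
  have hlag : ∀ m, Tendsto (fun k => lagStep x k m) atTop (𝓝 0) := by
    intro m
    induction m with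
    | zero =>
      rw [← tendsto_add_atTop_iff_nat 1]
      simpa only [lagStep_succ_zero] using hstep
    | succ m ih =>
      rw [← tendsto_add_atTop_iff_nat 1]
      simpa only [lagStep_succ_succ] using ih
  have hmem : Tendsto (fun k => memory δ x k) atTop (𝓝 0) := by
    have := tendsto_finsetSum (Finset.range δ) fun m _ => (hlag m).const_mul ((δ : ℝ) - m)
    simpa [memory] using this
  have hanti : Antitone (lyapunov (objective f g) δ Lf x) := by
    refine antitone_nat_of_succ_le fun k => ?_
    have := h.lyapunov_decrease hA hB hγ0 hγ1 k
    have := mul_nonneg hrate.le (gapSq_nonneg (X := X) (g := g) (ft := ft) x b y k)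
    linarith
  have hbdd : BddBelow (Set.range (lyapunov (objective f g) δ Lf x)) := by
    refine ⟨sInf (objective f g '' feasible X), ?_⟩
    rintro _ ⟨k, rfl⟩
    exact (hA.sInf_le_objective (h.mem k)).trans (objective_le_lyapunov x k)
  refine ⟨_, ((tendsto_atTop_ciInf hanti hbdd).sub (hmem.const_mul (δ * ((Lf : ℝ) / 2)))).congr
    fun k => ?_⟩
  rw [lyapunov_eq]; ring

/-- The squares of the stationarity measures of the updated blocks are summable. -/
theorem sum_statMap_updated_le (h : IsRun X g ft γ δ x b y) (hA : AssumptionA X O f g Lf Lg)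
    (hB : AssumptionB X f ft c LB LE) (hγ0 : 0 < γ)
    (hc : γ * min (Lf : ℝ) LB * δ ≤ c) (S : ℕ) :
    ∑ s ∈ Finset.range S, ‖statMap X f g (x s) (b s)‖ ^ 2
      ≤ (1 + LE + γ * min (Lf : ℝ) LB * δ) ^ 2
        * ∑ s ∈ Finset.range S, gapSq X g ft x b y s := by
  set L := min (Lf : ℝ) LB with hL
  have hL0 : 0 ≤ L := le_min Lf.2 LB.2
  set r := γ * L * δ with hr
  have hr0 : 0 ≤ r := by positivity
  set D := ∑ s ∈ Finset.range S, gapSq X g ft x b y s with hD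
  have hD0 : 0 ≤ D := Finset.sum_nonneg fun s _ => gapSq_nonneg x b y s
  set G : ℕ → ℝ := fun s => ‖blockGrad f (b s) (y s) - blockGrad f (b s) (x s)‖ with hG
  set d : ℕ → ℝ := fun s => ‖bestResponse X g ft (b s) (y s) - x s (b s)‖ with hd
  have hd2 : ∑ s ∈ Finset.range S, d s ^ 2 = D := rfl
  have hG2 : ∑ s ∈ Finset.range S, G s ^ 2 ≤ r ^ 2 * D := by
    calc ∑ s ∈ Finset.range S, G s ^ 2
        ≤ ∑ s ∈ Finset.range S, L ^ 2 * ‖x s - y s‖ ^ 2 := by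
          refine Finset.sum_le_sum fun s _ => ?_
          rw [← mul_pow]
          exact pow_le_pow_left₀ (norm_nonneg _) (h.gradient_error_le hA hB s) 2
      _ ≤ L ^ 2 * ((γ * δ) ^ 2 * D) := by
          rw [← Finset.mul_sum]
          exact mul_le_mul_of_nonneg_left (h.sum_delay_error_le S) (sq_nonneg _)
      _ = r ^ 2 * D := by rw [hr]; ring
  -- Cauchy–Schwarz over the iterations, rather than within each one, turns the bound on `∑ G²` into
  -- the factor `r`.
  have hGd : ∑ s ∈ Finset.range S, G s * d s ≤ r * D := by
    have h1 := Finset.sum_mul_sq_le_sq_mul_sq (Finset.range S) G d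
    rw [hd2] at h1
    refine le_of_sq_le_sq (h1.trans ?_) (by positivity)
    calc _ ≤ r ^ 2 * D * D := mul_le_mul_of_nonneg_right hG2 hD0
      _ = _ := by ring
  have hsum : ∑ s ∈ Finset.range S, ‖statMap X f g (x s) (b s)‖ ^ 2
      ≤ ∑ s ∈ Finset.range S, ((1 + LE) ^ 2 * d s ^ 2 + 2 * (2 + LE) * (G s * d s) + G s ^ 2
        - 2 * c * d s ^ 2) :=
    Finset.sum_le_sum fun s _ => statMap_block_le hA hB (h.mem s) (h.mem_delayed s) (h.own s)
  rw [Finset.sum_sub_distrib, Finset.sum_add_distrib, Finset.sum_add_distrib, ← Finset.mul_sum,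
    ← Finset.mul_sum, ← Finset.mul_sum, hd2] at hsum
  have hLE : (0 : ℝ) ≤ LE := LE.2
  have h2 : 2 * (2 + (LE : ℝ)) * ∑ s ∈ Finset.range S, G s * d s ≤ 2 * (2 + LE) * (r * D) :=
    mul_le_mul_of_nonneg_left hGd (by positivity)
  -- Completing the square to `(1 + L_E + r)²` leaves an excess `2 r D`, which the strong convexity
  -- term `2 c D` absorbs.
  have h3 : r * D ≤ c * D := mul_le_mul_of_nonneg_right hc hD0
  nlinarith

end IsRun

end AsyFlexa

/-! ### Windows of iterations and the pathwise complexity bound. -/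

namespace AsyFlexa

theorem sum_range_shift_le {a : ℕ → ℝ} (ha : ∀ s, 0 ≤ a s) {K j S : ℕ} (h : K + j ≤ S) :
    ∑ k ∈ Finset.range K, a (k + j) ≤ ∑ s ∈ Finset.range S, a s := by
  rw [← Finset.sum_image (g := fun k => k + j) (s := Finset.range K) (f := a)
    (fun p _ q _ hpq => by simpa using hpq)]
  refine Finset.sum_le_sum_of_subset_of_nonneg ?_ fun s _ _ => ha s
  intro s hs
  obtain ⟨k, hk, rfl⟩ := Finset.mem_image.1 hs
  rw [Finset.mem_range] at *
  omega

variable {N : ℕ} {n : Fin N → ℕ} {X : ∀ i, Set (EuclideanSpace ℝ (Fin (n i)))}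
  {O : Set (Vec n)} {f : Vec n → ℝ} {g : ∀ i, EuclideanSpace ℝ (Fin (n i)) → ℝ} {Lf Lg : ℝ≥0}
  {ft : ∀ i, EuclideanSpace ℝ (Fin (n i)) → Vec n → ℝ} {c : ℝ} {LB LE : ℝ≥0} {γ : ℝ} {δ : ℕ}

/-- The part of `‖M_F(x^k)‖²` in the blocks which are updated at one of the iterations
`k, …, k + T`. -/
noncomputable def windowStat (X : ∀ i, Set (EuclideanSpace ℝ (Fin (n i)))) (f : Vec n → ℝ)
    (g : ∀ i, EuclideanSpace ℝ (Fin (n i)) → ℝ) (T : ℕ) (x : ℕ → Vec n) (b : ℕ → Fin N)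
    (k : ℕ) : ℝ :=
  ∑ i ∈ (Finset.range (T + 1)).image (fun j => b (k + j)), ‖statMap X f g (x k) i‖ ^ 2

theorem exists_first_update {b : ℕ → Fin N} {T k : ℕ} {i : Fin N}
    (hi : i ∈ (Finset.range (T + 1)).image (fun j => b (k + j))) :
    ∃ j ≤ T, b (k + j) = i ∧ ∀ l < j, b (k + l) ≠ i := by
  classical
  have hex : ∃ j, b (k + j) = i := by
    obtain ⟨j, -, hj⟩ := Finset.mem_image.1 hi
    exact ⟨j, hj⟩
  refine ⟨Nat.find hex, ?_, Nat.find_spec hex, fun l hl => Nat.find_min hex hl⟩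
  obtain ⟨j, hjT, hj⟩ := Finset.mem_image.1 hi
  exact (Nat.find_min' hex hj).trans (Nat.lt_succ_iff.1 (Finset.mem_range.1 hjT))

namespace IsRun

variable {x : ℕ → Vec n} {b : ℕ → Fin N} {y : ℕ → Vec n}

/-- Drift of the blocks of `M_F` over the iterations at which they are not updated. -/
theorem sum_drift_le (h : IsRun X g ft γ δ x b y) (hA : AssumptionA X O f g Lf Lg)
    (hB : AssumptionB X f ft c LB LE) (k T : ℕ) (I : Finset (Fin N)) (σ : Fin N → ℕ)
    (hσ : ∀ i ∈ I, σ i ≤ T) (hfirst : ∀ i ∈ I, ∀ l < σ i, b (k + l) ≠ i) :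
    ∑ i ∈ I, ‖statMap X f g (x (k + σ i)) i - statMap X f g (x k) i‖ ^ 2
      ≤ min (Lf : ℝ) LB ^ 2
        * (T * γ ^ 2 * ∑ l ∈ Finset.range T, gapSq X g ft x b y (k + l)) := by
  set L := min (Lf : ℝ) LB with hL
  have hL0 : 0 ≤ L := le_min Lf.2 LB.2
  set M : Fin N → ℕ → ℝ := fun i l =>
    ‖statMap X f g (x (k + l + 1)) i - statMap X f g (x (k + l)) i‖ ^ 2 with hM
  -- Putting zero where block `i` is updated changes nothing before `σ i`, and lets the sum be
  -- extended to all `l < T`.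
  have h1 : ∀ i ∈ I, ‖statMap X f g (x (k + σ i)) i - statMap X f g (x k) i‖ ^ 2
      ≤ T * ∑ l ∈ Finset.range T, if i = b (k + l) then 0 else M i l := by
    intro i hi
    have e1 : ‖statMap X f g (x (k + σ i)) i - statMap X f g (x k) i‖
        ≤ ∑ l ∈ Finset.range (σ i),
          ‖statMap X f g (x (k + l + 1)) i - statMap X f g (x (k + l)) i‖ := by
      have := dist_le_range_sum_dist (fun l => statMap X f g (x (k + l)) i) (σ i)
      simpa [dist_eq_norm, norm_sub_rev, add_assoc] using this
    calc _ ≤ (∑ l ∈ Finset.range (σ i),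
          ‖statMap X f g (x (k + l + 1)) i - statMap X f g (x (k + l)) i‖) ^ 2 := by gcongr
      _ ≤ σ i * ∑ l ∈ Finset.range (σ i), M i l := by
          simpa using sq_sum_le_card_mul_sum_sq (s := Finset.range (σ i))
            (f := fun l => ‖statMap X f g (x (k + l + 1)) i - statMap X f g (x (k + l)) i‖)
      _ = σ i * ∑ l ∈ Finset.range (σ i), if i = b (k + l) then 0 else M i l := by
          congr 1
          refine Finset.sum_congr rfl fun l hl => ?_
          rw [if_neg (hfirst i hi l (Finset.mem_range.1 hl)).symm]
      _ ≤ _ := by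
          have hnn : ∀ l, 0 ≤ if i = b (k + l) then 0 else M i l := by
            intro l; split_ifs
            exacts [le_rfl, sq_nonneg _]
          refine mul_le_mul (by exact_mod_cast hσ i hi) ?_
            (Finset.sum_nonneg fun l _ => hnn l) (Nat.cast_nonneg T)
          exact Finset.sum_le_sum_of_subset_of_nonneg (Finset.range_mono (hσ i hi))
            fun l _ _ => hnn l
  calc _ ≤ ∑ i ∈ I, T * ∑ l ∈ Finset.range T, (if i = b (k + l) then 0 else M i l) :=
        Finset.sum_le_sum h1
    _ ≤ ∑ i, T * ∑ l ∈ Finset.range T, (if i = b (k + l) then 0 else M i l) := by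
        refine Finset.sum_le_sum_of_subset_of_nonneg (Finset.subset_univ _) fun i _ _ =>
          mul_nonneg (Nat.cast_nonneg T) (Finset.sum_nonneg fun l _ => ?_)
        split_ifs
        exacts [le_rfl, sq_nonneg _]
    -- After the interchange each iteration is handled once, for all blocks not updated in it
    -- together.
    _ = T * ∑ l ∈ Finset.range T, ∑ i ∈ Finset.univ.erase (b (k + l)), M i l := by
        rw [← Finset.mul_sum, Finset.sum_comm]
        congr 1
        refine Finset.sum_congr rfl fun l _ => ?_
        rw [← Finset.add_sum_erase _ _ (Finset.mem_univ (b (k + l))), if_pos rfl, zero_add]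
        exact Finset.sum_congr rfl fun i hi => if_neg (Finset.mem_erase.1 hi).1
    _ ≤ T * ∑ l ∈ Finset.range T, L ^ 2 * (γ ^ 2 * gapSq X g ft x b y (k + l)) := by
        refine mul_le_mul_of_nonneg_left (Finset.sum_le_sum fun l _ => ?_) (Nat.cast_nonneg T)
        rw [← h.norm_sub_sq]
        exact hA.sum_statMap_sub_le hL0
          (fun p hp q hq hpq => blockGrad_lipschitz hA hB hp hq hpq) (h.mem _) (h.mem _)
          fun i hi => h.succ_of_ne hi
    _ = _ := by
        simp only [← Finset.mul_sum]
        ring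

/-- Each block chosen in the window is compared with its value at its first update there. The
weighted Young inequality splits off the drift, whose total is controlled by `sum_drift_le`; the
weight is fitted to the constants wanted in the final bound. -/
theorem windowStat_le (h : IsRun X g ft γ δ x b y) (hA : AssumptionA X O f g Lf Lg)
    (hB : AssumptionB X f ft c LB LE) (T k : ℕ) {L θ : ℝ} (hL : L = min (Lf : ℝ) LB)
    (hθ : θ = L / (L + 2 * (1 + LE))) :
    windowStat X f g T x b k ≤ ‖statMap X f g (x k) (b k)‖ ^ 2
      + (1 + θ) * ∑ j ∈ Finset.range T, ‖statMap X f g (x (k + (j + 1))) (b (k + (j + 1)))‖ ^ 2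
      + 2 * L * (1 + LE + L)
        * (T * γ ^ 2 * ∑ l ∈ Finset.range T, gapSq X g ft x b y (k + l)) := by
  have hL0 : 0 ≤ L := hL ▸ le_min Lf.2 LB.2
  have hLE : (0 : ℝ) ≤ LE := LE.2
  set I := (Finset.range (T + 1)).image (fun j => b (k + j)) with hI
  have hex : ∀ i, ∃ j, i ∈ I → j ≤ T ∧ b (k + j) = i ∧ ∀ l < j, b (k + l) ≠ i := by
    intro i
    by_cases hi : i ∈ I
    · obtain ⟨j, hj⟩ := exists_first_update hi
      exact ⟨j, fun _ => hj⟩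
    · exact ⟨0, fun hi' => absurd hi' hi⟩
  choose σ hσ using hex
  set D := T * γ ^ 2 * ∑ l ∈ Finset.range T, gapSq X g ft x b y (k + l) with hD
  have hD0 : 0 ≤ D := mul_nonneg (by positivity) (Finset.sum_nonneg fun l _ => gapSq_nonneg x b y _)
  set B : Fin N → ℝ := fun i => ‖statMap X f g (x (k + σ i)) i - statMap X f g (x k) i‖ with hBdef
  have hdrift : ∑ i ∈ I, B i ^ 2 ≤ L ^ 2 * D := by
    rw [hL]
    exact h.sum_drift_le hA hB k T I σ (fun i hi => (hσ i hi).1) fun i hi => (hσ i hi).2.2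
  -- If `L = 0` the drift vanishes, which agrees with the convention that division by zero gives
  -- zero.
  have hBL : ∀ i ∈ I, B i ≤ L * (B i / L) := by
    intro i hi
    rcases hL0.eq_or_lt with h0 | h0
    · have h1 : B i ^ 2 ≤ ∑ i ∈ I, B i ^ 2 :=
        Finset.single_le_sum (f := fun i => B i ^ 2) (fun _ _ => sq_nonneg _) hi
      rw [← h0] at hdrift ⊢
      have h2 : B i ^ 2 ≤ 0 := by linarith
      have h3 : B i = 0 := pow_eq_zero_iff two_ne_zero |>.1 (le_antisymm h2 (sq_nonneg _))
      simp [h3]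
    · rw [mul_div_cancel₀ _ h0.ne']
  have hBsum : ∑ i ∈ I, (B i / L) ^ 2 ≤ D := by
    simp only [div_pow, ← Finset.sum_div]
    rcases hL0.eq_or_lt with h0 | h0
    · rw [← h0]; simpa using hD0
    · rw [div_le_iff₀ (by positivity), mul_comm]; exact hdrift
  -- A block updated at iteration `k` itself has no drift and needs no Young factor.
  set W : ℕ → ℝ := fun j => (if j = 0 then 1 else 1 + θ)
    * ‖statMap X f g (x (k + j)) (b (k + j))‖ ^ 2 with hW
  have hθ0 : 0 ≤ θ := by rw [hθ]; positivity
  have hW0 : ∀ j, 0 ≤ W j := fun j => by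
    refine mul_nonneg ?_ (sq_nonneg _)
    split_ifs <;> linarith
  have hterm : ∀ i ∈ I, ‖statMap X f g (x k) i‖ ^ 2
      ≤ W (σ i) + 2 * L * (1 + LE + L) * (B i / L) ^ 2 := by
    intro i hi
    obtain ⟨-, hb, -⟩ := hσ i hi
    by_cases h0 : σ i = 0
    · have : W (σ i) = ‖statMap X f g (x k) i‖ ^ 2 := by
        rw [h0, add_zero] at hb
        have hn := congrArg (fun l => ‖statMap X f g (x k) l‖) hb
        simp only at hn
        simp [hW, h0, hn]
      rw [this]
      exact le_add_of_nonneg_right (by positivity)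
    · have e : W (σ i) = (1 + θ) * ‖statMap X f g (x (k + σ i)) i‖ ^ 2 := by
        have hn := congrArg (fun l => ‖statMap X f g (x (k + σ i)) l‖) hb
        simp only at hn
        simp only [hW, if_neg h0, hn]
      rw [e, hθ]
      refine le_trans ?_ (add_sq_le_weighted hL0 (u := 1 + LE) (by positivity)
        (norm_nonneg (statMap X f g (x (k + σ i)) i)) (norm_nonneg _) (hBL i hi))
      gcongr
      have := norm_sub_norm_le (statMap X f g (x k) i) (statMap X f g (x (k + σ i)) i)
      rw [norm_sub_rev] at this
      linarith
  -- Different blocks have different first update times, since one iteration updates one block.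
  have hWsum : ∑ i ∈ I, W (σ i) ≤ ∑ j ∈ Finset.range (T + 1), W j := by
    rw [← Finset.sum_image (g := σ) (s := I) (f := W) (fun p hp q hq hpq => by
      rw [← (hσ p hp).2.1, ← (hσ q hq).2.1, hpq])]
    refine Finset.sum_le_sum_of_subset_of_nonneg ?_ fun s _ _ => hW0 s
    intro s hs
    obtain ⟨i, hi, rfl⟩ := Finset.mem_image.1 hs
    exact Finset.mem_range.2 (Nat.lt_succ_of_le (hσ i hi).1)
  have hWeq : ∑ j ∈ Finset.range (T + 1), W j = ‖statMap X f g (x k) (b k)‖ ^ 2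
      + (1 + θ) * ∑ j ∈ Finset.range T,
        ‖statMap X f g (x (k + (j + 1))) (b (k + (j + 1)))‖ ^ 2 := by
    rw [Finset.sum_range_succ', add_comm, Finset.mul_sum]
    simp [hW]
  calc windowStat X f g T x b k
      ≤ ∑ i ∈ I, (W (σ i) + 2 * L * (1 + LE + L) * (B i / L) ^ 2) := Finset.sum_le_sum hterm
    _ = ∑ i ∈ I, W (σ i) + 2 * L * (1 + LE + L) * ∑ i ∈ I, (B i / L) ^ 2 := by
        rw [Finset.sum_add_distrib, Finset.mul_sum]
    _ ≤ _ := by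
        rw [← hWeq]
        exact add_le_add hWsum (mul_le_mul_of_nonneg_left hBsum (by positivity))

/-- The pathwise complexity estimate. -/
theorem sum_windowStat_le (h : IsRun X g ft γ δ x b y) (hA : AssumptionA X O f g Lf Lg)
    (hB : AssumptionB X f ft c LB LE) (hγ0 : 0 < γ) (hγ1 : γ ≤ 1)
    (hstep : γ * (Lf + (δ : ℝ) ^ 2 * Lf / 2) < c) {T : ℕ} (hT : 1 ≤ T) (K : ℕ) :
    ∑ k ∈ Finset.range K, windowStat X f g T x b k
      ≤ 2 * ((1 + LE) * (1 + LB + LE)) * (T + 1)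
          * ∑ s ∈ Finset.range (K + T), gapSq X g ft x b y s
        + 2 * T * LB * (1 + LB + LE) * γ ^ 2
          * (∑ k ∈ Finset.range K, ∑ l ∈ Finset.range T, gapSq X g ft x b y (k + l)
            + ∑ s ∈ Finset.range (K + T), gapSq X g ft x b y s) := by
  set L := min (Lf : ℝ) LB with hL
  have hL0 : 0 ≤ L := le_min Lf.2 LB.2
  have hLLB : L ≤ LB := min_le_right _ _
  have hLLf : L ≤ Lf := min_le_left _ _
  have hLE : (0 : ℝ) ≤ LE := LE.2
  have hLB : (0 : ℝ) ≤ LB := LB.2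
  set θ := L / (L + 2 * (1 + LE)) with hθ
  have hθ0 : 0 ≤ θ := by positivity
  set A : ℕ → ℝ := fun s => ‖statMap X f g (x s) (b s)‖ ^ 2 with hAdef
  have hA0 : ∀ s, 0 ≤ A s := fun s => sq_nonneg _
  set D := ∑ s ∈ Finset.range (K + T), gapSq X g ft x b y s with hD
  have hD0 : 0 ≤ D := Finset.sum_nonneg fun s _ => gapSq_nonneg x b y s
  set E := ∑ k ∈ Finset.range K, ∑ l ∈ Finset.range T, gapSq X g ft x b y (k + l) with hE
  have hE0 : 0 ≤ E :=
    Finset.sum_nonneg fun k _ => Finset.sum_nonneg fun s _ => gapSq_nonneg x b y _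
  have hstepL : γ * L * (2 + (δ : ℝ) ^ 2) ≤ 2 * c := by
    have : γ * L * (2 + (δ : ℝ) ^ 2) ≤ γ * Lf * (2 + (δ : ℝ) ^ 2) := by gcongr
    nlinarith
  have hcr : γ * L * δ ≤ c := by
    have h0 : 0 ≤ γ * L := mul_nonneg hγ0.le hL0
    have h1 : γ * L * (2 * δ) ≤ γ * L * (2 + (δ : ℝ) ^ 2) :=
      mul_le_mul_of_nonneg_left (by nlinarith [sq_nonneg ((δ : ℝ) - 1)]) h0
    linarith
  -- the sum over all windows
  have h1 : ∑ k ∈ Finset.range K, windowStat X f g T x b k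
      ≤ ((T : ℝ) + 1 + T * θ) * ∑ s ∈ Finset.range (K + T), A s
        + 2 * L * (1 + LE + L) * (T * γ ^ 2 * E) := by
    have e := Finset.sum_le_sum (s := Finset.range K) fun k _ =>
      h.windowStat_le hA hB T k hL hθ
    rw [Finset.sum_add_distrib, Finset.sum_add_distrib, ← Finset.mul_sum, ← Finset.mul_sum,
      ← Finset.mul_sum, ← hE] at e
    have e1 : ∑ k ∈ Finset.range K, A k ≤ ∑ s ∈ Finset.range (K + T), A s :=
      sum_range_shift_le hA0 (j := 0) (by omega)
    -- Each iteration lies at a positive offset in at most `T` windows, and at offset zero in at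
    -- most one.
    have e2 : ∑ k ∈ Finset.range K, ∑ j ∈ Finset.range T, A (k + (j + 1))
        ≤ T * ∑ s ∈ Finset.range (K + T), A s := by
      rw [Finset.sum_comm]
      calc _ ≤ ∑ _j ∈ Finset.range T, ∑ s ∈ Finset.range (K + T), A s :=
            Finset.sum_le_sum fun j hj => sum_range_shift_le hA0 (by
              have := Finset.mem_range.1 hj; omega)
        _ = _ := by simp
    have e3 := mul_le_mul_of_nonneg_left e2 (by linarith : 0 ≤ 1 + θ)
    refine e.trans ?_
    linarith
  -- the updated blocks
  have h2 : ((T : ℝ) + 1 + T * θ) * ∑ s ∈ Finset.range (K + T), A s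
      ≤ (2 * ((1 + LE) * (1 + LE + L)) * (T + 1) + 2 * T * L * (1 + LE + L) * γ ^ 2) * D := by
    -- If `L_E < c`, nothing moves and all gaps vanish. Otherwise `c ≤ 1 + L_E`, so the step-size
    -- condition takes the form needed by `weight_bound` with `u = 1 + L_E`.
    by_cases hc : (LE : ℝ) < c
    · have hz : ∑ s ∈ Finset.range (K + T), gapSq X g ft x b y s = 0 := by
        refine Finset.sum_eq_zero fun s _ => ?_
        unfold gapSq
        rw [← h.own, bestResponse_eq_of_lt hA hB hc (b s) (h.mem_delayed s)]
        simp
      have := h.sum_statMap_updated_le hA hB hγ0 hcr (K + T)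
      rw [hz, mul_zero] at this
      rw [hD, hz, mul_zero]
      exact mul_nonpos_of_nonneg_of_nonpos (by positivity) this
    · push Not at hc
      have e1 := h.sum_statMap_updated_le hA hB hγ0 hcr (K + T)
      have e2 := weight_bound (u := 1 + LE) hL0 (by positivity) hγ0 hγ1 hT
        (hstepL.trans (by linarith))
      calc _ ≤ ((T : ℝ) + 1 + T * θ) * ((1 + LE + γ * L * δ) ^ 2 * D) :=
            mul_le_mul_of_nonneg_left e1 (by positivity)
        _ = (((T : ℝ) + 1 + T * θ) * (1 + LE + γ * L * δ) ^ 2) * D := by ring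
        _ ≤ _ := mul_le_mul_of_nonneg_right e2 hD0
  clear_value D E θ
  have h3 : L * (1 + LE + L) ≤ LB * (1 + LB + LE) := by
    have : L * (1 + LE + L) ≤ LB * (1 + LE + LB) := by gcongr
    linarith
  have h4 : (1 + (LE : ℝ)) * (1 + LE + L) ≤ (1 + LE) * (1 + LB + LE) := by
    refine mul_le_mul_of_nonneg_left (by linarith) (by positivity)
  have h5 : 2 * T * γ ^ 2 * (E + D) * (L * (1 + LE + L))
      ≤ 2 * T * γ ^ 2 * (E + D) * (LB * (1 + LB + LE)) :=
    mul_le_mul_of_nonneg_left h3 (mul_nonneg (by positivity) (add_nonneg hE0 hD0))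
  have h6 : 2 * ((T : ℝ) + 1) * D * ((1 + (LE : ℝ)) * (1 + LE + L))
      ≤ 2 * ((T : ℝ) + 1) * D * ((1 + LE) * (1 + LB + LE)) :=
    mul_le_mul_of_nonneg_left h4 (mul_nonneg (by positivity) hD0)
  linarith

end IsRun

end AsyFlexa

namespace AsyFlexa

/-! ### Finite histories and conditional selection probabilities. -/

section Prefix

variable {N : ℕ} {D : Finset (Fin N → ℕ)}

/-- The first `m` elements of a sample sequence. -/
def samplePrefix (m : ℕ) (ω : Sample D) : Fin m → Fin N × D := fun t => ω t

theorem measurable_samplePrefix (m : ℕ) : Measurable (samplePrefix (D := D) m) :=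
  measurable_pi_lambda _ fun t => measurable_pi_apply (t : ℕ)

theorem samplePrefix_eq_iff {m : ℕ} {ω ω' : Sample D} :
    samplePrefix m ω = samplePrefix m ω' ↔ ∀ t < m, ω t = ω' t :=
  ⟨fun h t ht => congrFun h ⟨t, ht⟩, fun h => funext fun t => h t t.2⟩

theorem cylinder_eq_preimage (m : ℕ) (ω : Sample D) :
    cylinder m ω = samplePrefix m ⁻¹' {samplePrefix m ω} := by
  ext ω'
  simp [cylinder, samplePrefix_eq_iff]

theorem measurableSet_cylinder (m : ℕ) (ω : Sample D) : MeasurableSet (cylinder m ω) := by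
  rw [cylinder_eq_preimage]
  exact measurable_samplePrefix m (measurableSet_singleton _)

/-- A function that depends on the first `m` elements only factors through them. -/
theorem exists_factor {m : ℕ} {h : Sample D → ℝ}
    (hh : ∀ ω ω', (∀ t < m, ω t = ω' t) → h ω = h ω') :
    ∃ φ : (Fin m → Fin N × D) → ℝ, ∀ ω, h ω = φ (samplePrefix m ω) := by
  have hf : Function.FactorsThrough h (samplePrefix m) := fun ω ω' e =>
    hh ω ω' (samplePrefix_eq_iff.1 e)
  exact ⟨Function.extend (samplePrefix m) h 0, fun ω => (hf.extend_apply 0 ω).symm⟩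

/-- There are only finitely many histories of length `m`, so no measurability of the problem data is
required. -/
theorem integrable_of_prefix (P : Measure (Sample D)) [IsFiniteMeasure P] (m : ℕ)
    {h : Sample D → ℝ} (hh : ∀ ω ω', (∀ t < m, ω t = ω' t) → h ω = h ω') : Integrable h P := by
  obtain ⟨φ, hφ⟩ := exists_factor hh
  have : Integrable (φ ∘ samplePrefix m) P :=
    (Integrable.of_finite (f := φ)).comp_measurable (measurable_samplePrefix m)
  exact this.congr (Eventually.of_forall fun ω => (hφ ω).symm)

theorem measureReal_eq_sum_preimage {Ω ι : Type*} [MeasurableSpace Ω] [Fintype ι]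
    [MeasurableSpace ι] [MeasurableSingletonClass ι] (P : Measure Ω) [IsFiniteMeasure P]
    {φ : Ω → ι} (hφ : Measurable φ) {E : Set Ω} (hE : MeasurableSet E) :
    P.real E = ∑ a, P.real (E ∩ φ ⁻¹' {a}) := by
  have h : E = ⋃ a ∈ (Finset.univ : Finset ι), E ∩ φ ⁻¹' {a} := by
    ext ω; simp
  conv_lhs => rw [h]
  refine measureReal_biUnion_finset ?_ fun a _ => hE.inter (hφ (measurableSet_singleton a))
  intro a _ a' _ hne
  refine Set.disjoint_left.2 fun ω h1 h2 => hne ?_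
  rw [← h1.2, ← h2.2]

theorem integral_indicator_prefix (P : Measure (Sample D)) [IsFiniteMeasure P] (m : ℕ)
    (φ : (Fin m → Fin N × D) → ℝ) {E : Set (Sample D)} (hE : MeasurableSet E) :
    ∫ ω, E.indicator (fun ω => φ (samplePrefix m ω)) ω ∂P
      = ∑ p, φ p * P.real (E ∩ samplePrefix m ⁻¹' {p}) := by
  classical
  have hm : ∀ p, MeasurableSet (E ∩ samplePrefix (D := D) m ⁻¹' {p}) := fun p =>
    hE.inter (measurable_samplePrefix m (measurableSet_singleton p))
  have h : ∀ ω, E.indicator (fun ω => φ (samplePrefix m ω)) ω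
      = ∑ p, (E ∩ samplePrefix m ⁻¹' {p}).indicator (fun _ => φ p) ω := by
    intro ω
    by_cases hω : ω ∈ E
    · simp [Set.indicator, hω]
    · simp [Set.indicator, hω]
  simp only [h]
  rw [integral_finsetSum _ fun p _ => (integrable_const (φ p)).indicator (hm p)]
  refine Finset.sum_congr rfl fun p _ => ?_
  rw [integral_indicator_const _ (hm p), smul_eq_mul, mul_comm]

/-- Block `i` is chosen at one of the iterations `s, …, s + r`. -/
def chosenWithin (i : Fin N) (s r : ℕ) : Set (Sample D) := {ω | ∃ j ≤ r, (ω (s + j)).1 = i}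

theorem measurableSet_chosenWithin (i : Fin N) (s r : ℕ) :
    MeasurableSet (chosenWithin (D := D) i s r) := by
  have : chosenWithin (D := D) i s r
      = ⋃ j ∈ Set.Iic r, (fun ω : Sample D => ω (s + j)) ⁻¹' {a | a.1 = i} := by
    ext ω; simp [chosenWithin]
  rw [this]
  exact MeasurableSet.biUnion (Set.to_countable _) fun j _ =>
    measurable_pi_apply (s + j) (Set.toFinite _).measurableSet

theorem cylinder_inter_eq (s : ℕ) (ω : Sample D) (a : Fin N × D) :
    cylinder s ω ∩ (fun ω' : Sample D => ω' s) ⁻¹' {a}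
      = cylinder (s + 1) (Function.update ω s a) := by
  ext ω'
  simp only [cylinder, Set.mem_inter_iff, Set.mem_ofPred_eq, Set.mem_preimage,
    Set.mem_singleton_iff]
  constructor
  · rintro ⟨h1, h2⟩ t ht
    rcases Nat.lt_succ_iff_lt_or_eq.1 ht with h | rfl
    · rw [Function.update_of_ne h.ne]; exact h1 t h
    · rw [Function.update_self]; exact h2
  · intro h
    refine ⟨fun t ht => ?_, ?_⟩
    · rw [h t (by omega), Function.update_of_ne ht.ne]
    · rw [h s (by omega), Function.update_self]

theorem cylinder_congr {s : ℕ} {ω ω' : Sample D} (h : ω' ∈ cylinder s ω) :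
    cylinder s ω' = cylinder s ω := by
  ext ω''
  exact ⟨fun h' t ht => (h' t ht).trans (h t ht), fun h' t ht => (h' t ht).trans (h t ht).symm⟩

theorem sum_condProb (P : Measure (Sample D)) [IsFiniteMeasure P] (s : ℕ) (ω : Sample D)
    (i : Fin N) :
    ∑ d : D, condProb P s ω (i, d)
      = P.real (cylinder s ω ∩ {ω' | (ω' s).1 = i}) / P.real (cylinder s ω) := by
  unfold condProb
  rw [← Finset.sum_div]
  congr 1
  have hm : MeasurableSet {ω' : Sample D | (ω' s).1 = i} :=
    measurable_fst.comp (measurable_pi_apply s) (measurableSet_singleton i)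
  rw [measureReal_eq_sum_preimage P (φ := fun ω' : Sample D => (ω' s).2)
    (measurable_snd.comp (measurable_pi_apply s)) ((measurableSet_cylinder s ω).inter hm)]
  refine Finset.sum_congr rfl fun d _ => ?_
  congr 1
  ext ω'
  simp only [Set.mem_inter_iff, Set.mem_ofPred_eq, Set.mem_preimage, Set.mem_singleton_iff,
    Prod.ext_iff, and_assoc]

/-- If along every continuation of a history there is an iteration within the next `r` at which
block `i` has conditional probability at least `pmin`, then block `i` is chosen within these
iterations with conditional probability at least `pmin`. -/
theorem measureReal_chosenWithin_ge (P : Measure (Sample D)) [IsFiniteMeasure P] {pmin : ℝ}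
    (i : Fin N) (r : ℕ) : ∀ (s : ℕ) (ω : Sample D),
      (∀ ω' ∈ cylinder s ω, ∃ t ≤ r, 0 < P.real (cylinder (s + t) ω') →
        pmin ≤ ∑ d : D, condProb P (s + t) ω' (i, d)) →
      pmin * P.real (cylinder s ω) ≤ P.real (cylinder s ω ∩ chosenWithin i s r) := by
  have now : ∀ (s : ℕ) (ω : Sample D) (r : ℕ), (0 < P.real (cylinder s ω) →
      pmin ≤ ∑ d : D, condProb P s ω (i, d)) →
      pmin * P.real (cylinder s ω) ≤ P.real (cylinder s ω ∩ chosenWithin i s r) := by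
    intro s ω r h
    rcases (measureReal_nonneg (μ := P) (s := cylinder s ω)).eq_or_lt with h0 | h0
    · rw [← h0, mul_zero]; exact measureReal_nonneg
    · have h1 := h h0
      rw [sum_condProb, le_div_iff₀ h0] at h1
      refine h1.trans (measureReal_mono (Set.inter_subset_inter_right _ fun ω' hω' => ?_))
      exact ⟨0, Nat.zero_le r, hω'⟩
  induction r with
  | zero =>
    intro s ω h
    obtain ⟨t, ht, h1⟩ := h ω fun _ _ => rfl
    obtain rfl : t = 0 := by omega
    exact now s ω 0 h1
  | succ r ih =>
    intro s ω h
    by_cases hg : 0 < P.real (cylinder s ω) → pmin ≤ ∑ d : D, condProb P s ω (i, d)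
    · exact now s ω _ hg
    -- The current iteration is not favourable, so both sides are split according to element `s`,
    -- and the induction hypothesis applies to each one-step continuation.
    · rw [measureReal_eq_sum_preimage P (measurable_pi_apply s) (measurableSet_cylinder s ω),
        measureReal_eq_sum_preimage P (measurable_pi_apply s)
          ((measurableSet_cylinder s ω).inter (measurableSet_chosenWithin i s (r + 1))),
        Finset.mul_sum]
      refine Finset.sum_le_sum fun a _ => ?_
      rw [Set.inter_right_comm]
      have e := cylinder_inter_eq s ω a
      rw [e]
      refine (ih (s + 1) (Function.update ω s a) fun ω' hω' => ?_).trans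
        (measureReal_mono (Set.inter_subset_inter_right _ ?_))
      · have hω's : ω' ∈ cylinder s ω := by
          rw [← e] at hω'; exact hω'.1
        obtain ⟨t, ht, h1⟩ := h ω' hω's
        cases t with
        | zero =>
          -- The condition at offset zero depends only on the history up to `s`, which is common to
          -- all continuations; its failure for `ω` excludes offset zero for all of them.
          refine absurd ?_ hg
          have hcyl := cylinder_congr hω's
          simp only [add_zero, condProb, hcyl] at h1
          exact h1
        | succ t =>
          refine ⟨t, by omega, ?_⟩
          rw [add_right_comm, add_assoc]; exact h1
      · rintro ω' ⟨j, hj, h1⟩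
        exact ⟨j + 1, by omega, by rw [← h1]; congr 2; omega⟩

/-- Both integrals are finite sums over histories of length `k`, on which `h` is constant; the
inequality holds history by history. -/
theorem AssumptionC.integral_le {P : Measure (Sample D)} [IsFiniteMeasure P] {δ T : ℕ} {pmin : ℝ}
    (hC : AssumptionC P δ T pmin) (i : Fin N) (k : ℕ) {h : Sample D → ℝ} (h0 : ∀ ω, 0 ≤ h ω)
    (hh : ∀ ω ω', (∀ t < k, ω t = ω' t) → h ω = h ω') :
    pmin * ∫ ω, h ω ∂P ≤ ∫ ω, (chosenWithin i k T).indicator h ω ∂P := by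
  obtain ⟨φ, hφ⟩ := exists_factor hh
  obtain rfl : h = fun ω => φ (samplePrefix k ω) := funext hφ
  have e1 := integral_indicator_prefix P k φ MeasurableSet.univ
  simp only [Set.indicator_univ, Set.univ_inter] at e1
  rw [e1, integral_indicator_prefix P k φ (measurableSet_chosenWithin i k T), Finset.mul_sum]
  refine Finset.sum_le_sum fun p _ => ?_
  by_cases hp : ∃ ω, samplePrefix (D := D) k ω = p
  · obtain ⟨ω, rfl⟩ := hp
    rw [← cylinder_eq_preimage, Set.inter_comm]
    have := measureReal_chosenWithin_ge P (pmin := pmin) i T k ω fun ω' _ => hC.often i ω' k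
    have := mul_le_mul_of_nonneg_left this (h0 ω)
    linarith
  · have : samplePrefix (D := D) k ⁻¹' {p} = ∅ := by
      ext ω; simpa using fun e => hp ⟨ω, e⟩
    simp [this]

end Prefix

/-! ### The random iterates as runs, and integrability. -/

section Algorithm

variable {N : ℕ} {n : Fin N → ℕ} {X : ∀ i, Set (EuclideanSpace ℝ (Fin (n i)))}
  {O : Set (Vec n)} {f : Vec n → ℝ} {g : ∀ i, EuclideanSpace ℝ (Fin (n i)) → ℝ} {Lf Lg : ℝ≥0}
  {ft : ∀ i, EuclideanSpace ℝ (Fin (n i)) → Vec n → ℝ} {c : ℝ} {LB LE : ℝ≥0} {γ : ℝ} {δ T : ℕ}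
  {D : Finset (Fin N → ℕ)} {P : Measure (Sample D)} {pmin : ℝ} {x0 : Vec n}

theorem history_congr (k : ℕ) : ∀ (l : ℕ) {ω ω' : Sample D}, (∀ t < k, ω t = ω' t) →
    history X g ft γ x0 ω k l = history X g ft γ x0 ω' k l := by
  induction k with
  | zero => intro l ω ω' _; rfl
  | succ k ih =>
    intro l ω ω' h
    have h' : ∀ t < k, ω t = ω' t := fun t ht => h t (by omega)
    cases l with
    | zero => simp only [history, h k (by omega), fun l => ih l h']
    | succ l => exact ih l h'

theorem iterate_congr {k : ℕ} {ω ω' : Sample D} (h : ∀ t < k, ω t = ω' t) :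
    iterate X g ft γ x0 ω k = iterate X g ft γ x0 ω' k :=
  history_congr k 0 h

theorem iterate_zero (ω : Sample D) : iterate X g ft γ x0 ω 0 = x0 := rfl

theorem step_mem (hA : AssumptionA X O f g Lf Lg) (hB : AssumptionB X f ft c LB LE)
    (hγ0 : 0 < γ) (hγ1 : γ ≤ 1) (i : Fin N) {x y : Vec n} (hx : x ∈ feasible X)
    (hy : y ∈ feasible X) : step X g ft γ i x y ∈ feasible X := by
  rw [step_eq]
  refine setBlock_mem hx ?_
  have e : x i + γ • (bestResponse X g ft i y - x i)
      = (1 - γ) • x i + γ • bestResponse X g ft i y := by module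
  rw [e]
  exact hA.convex i (hx i) (bestResponse_mem hA hB i hy) (by linarith) hγ0.le (by ring)

theorem iterate_mem (hA : AssumptionA X O f g Lf Lg) (hB : AssumptionB X f ft c LB LE)
    (hγ0 : 0 < γ) (hγ1 : γ ≤ 1) (hx0 : x0 ∈ feasible X) (ω : Sample D) (k : ℕ) :
    iterate X g ft γ x0 ω k ∈ feasible X := by
  induction k using Nat.strong_induction_on with
  | _ k ih =>
    cases k with
    | zero => exact hx0
    | succ k =>
      rw [iterate_succ]
      exact step_mem hA hB hγ0 hγ1 _ (ih k (by omega)) fun j => ih _ (by omega) j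

theorem isRun_iterate (hA : AssumptionA X O f g Lf Lg) (hB : AssumptionB X f ft c LB LE)
    (hC : AssumptionC P δ T pmin) (hγ0 : 0 < γ) (hγ1 : γ ≤ 1) (hx0 : x0 ∈ feasible X)
    {ω : Sample D} (hω : ∀ k : ℕ, (ω k).2.1 (ω k).1 = 0) :
    IsRun X g ft γ δ (iterate X g ft γ x0 ω) (fun k => (ω k).1)
      (fun k => WithLp.toLp 2 fun j => iterate X g ft γ x0 ω (k - (ω k).2.1 j) j) where
  mem := iterate_mem hA hB hγ0 hγ1 hx0 ω
  mem_delayed k j := iterate_mem hA hB hγ0 hγ1 hx0 ω _ j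
  own k := by simp [hω k]
  delay k j := ⟨(ω k).2.1 j, hC.bounded_delay _ (ω k).2.2 j, rfl⟩
  succ k := iterate_succ X g ft γ x0 ω k

theorem integrable_statMap (P : Measure (Sample D)) [IsFiniteMeasure P] (k : ℕ) :
    Integrable (fun ω => ‖statMap X f g (iterate X g ft γ x0 ω k)‖ ^ 2) P :=
  integrable_of_prefix P k fun _ _ h => by rw [iterate_congr h]

theorem integrable_windowStat (P : Measure (Sample D)) [IsFiniteMeasure P] (T k : ℕ) :
    Integrable (fun ω => windowStat X f g T (iterate X g ft γ x0 ω) (fun k => (ω k).1) k) P := by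
  refine integrable_of_prefix P (k + T + 1) fun ω ω' h => ?_
  unfold windowStat
  rw [iterate_congr fun t ht => h t (by omega)]
  congr 1
  refine Finset.image_congr fun j hj => ?_
  have hj' : j < T + 1 := by simpa using hj
  exact congrArg Prod.fst (h (k + j) (by omega))

theorem integrable_weightedDecrease (P : Measure (Sample D)) [IsFiniteMeasure P] (F : Vec n → ℝ)
    (L : ℝ) (k : ℕ) :
    Integrable (fun ω => weightedDecrease F δ T L (iterate X g ft γ x0 ω) ω k) P := by
  refine integrable_of_prefix P (k + T + 1) fun ω ω' h => ?_
  have hpast : ∀ i, ∀ l ≤ k + T, pastUpdates δ ω i l = pastUpdates δ ω' i l := by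
    intro i l hl
    refine Finset.filter_congr fun t ht => ?_
    rw [h t (by have := (Finset.mem_Ico.1 ht).2; omega)]
  have hmax : ∀ i, maxUpdates δ T ω i k = maxUpdates δ T ω' i k := by
    intro i
    refine Finset.sup_congr rfl fun l hl => ?_
    rw [hpast i l (Finset.mem_Icc.1 hl).2]
  have hupd : ∀ i, updates δ T ω i k = updates δ T ω' i k := by
    intro i
    refine Finset.filter_congr fun t ht => ?_
    rw [h t (by have := (Finset.mem_Ico.1 ht).2; omega)]
  have hlyap : ∀ t ≤ k + T, lyapunov F δ L (iterate X g ft γ x0 ω) t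
      = lyapunov F δ L (iterate X g ft γ x0 ω') t := by
    intro t ht
    have hit : ∀ s ≤ t, iterate X g ft γ x0 ω s = iterate X g ft γ x0 ω' s := fun s hs =>
      iterate_congr fun u hu => h u (by omega)
    rw [lyapunov_eq, lyapunov_eq, hit t le_rfl]
    congr 2
    unfold memory lagStep
    refine Finset.sum_congr rfl fun m _ => ?_
    rw [hit _ (by omega), hit _ (by omega)]
  unfold weightedDecrease
  refine Finset.sum_congr rfl fun i _ => ?_
  rw [hmax i, hupd i]
  congr 1
  refine Finset.sum_congr rfl fun t ht => ?_
  have ht' : t < k + T := (Finset.mem_Ico.1 (Finset.mem_filter.1 ht).1).2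
  rw [hlyap t (by omega), hlyap (t + 1) (by omega)]

/-- `‖M_F(x^k)‖²` is split into blocks. Each summand is a function of the history before `k`, so
restricting it to the event that its block is chosen in the window costs at most the factor `pmin`.
-/
theorem pmin_mul_meanSqStat_le [IsFiniteMeasure P] (hC : AssumptionC P δ T pmin) (k : ℕ) :
    pmin * meanSqStat P X f g ft γ x0 k
      ≤ ∫ ω, windowStat X f g T (iterate X g ft γ x0 ω) (fun k => (ω k).1) k ∂P := by
  classical
  have hpre : ∀ i, ∀ ω ω' : Sample D, (∀ t < k, ω t = ω' t) →
      ‖statMap X f g (iterate X g ft γ x0 ω k) i‖ ^ 2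
        = ‖statMap X f g (iterate X g ft γ x0 ω' k) i‖ ^ 2 := fun i ω ω' h => by
    rw [iterate_congr h]
  have hint : ∀ i, Integrable
      (fun ω : Sample D => ‖statMap X f g (iterate X g ft γ x0 ω k) i‖ ^ 2) P := fun i =>
    integrable_of_prefix P k (hpre i)
  have e1 : meanSqStat P X f g ft γ x0 k
      = ∑ i, ∫ ω, ‖statMap X f g (iterate X g ft γ x0 ω k) i‖ ^ 2 ∂P := by
    unfold meanSqStat
    simp only [norm_sq_eq_sum]
    exact integral_finsetSum _ fun i _ => hint i
  have e2 : ∫ ω, windowStat X f g T (iterate X g ft γ x0 ω) (fun k => (ω k).1) k ∂P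
      = ∑ i, ∫ ω, (chosenWithin i k T).indicator
        (fun ω => ‖statMap X f g (iterate X g ft γ x0 ω k) i‖ ^ 2) ω ∂P := by
    rw [← integral_finsetSum _ fun i _ =>
      (hint i).indicator (measurableSet_chosenWithin i k T)]
    refine integral_congr_ae (Eventually.of_forall fun ω => ?_)
    simp only [windowStat]
    rw [← Finset.sum_filter_add_sum_filter_not Finset.univ
      (fun i => i ∈ (Finset.range (T + 1)).image fun j => (ω (k + j)).1)
      (fun i => (chosenWithin i k T).indicator
        (fun ω => ‖statMap X f g (iterate X g ft γ x0 ω k) i‖ ^ 2) ω)]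
    have hiff : ∀ i, i ∈ (Finset.range (T + 1)).image (fun j => (ω (k + j)).1)
        ↔ ω ∈ chosenWithin i k T := by
      intro i
      simp [chosenWithin]
    rw [Finset.sum_eq_zero (s := Finset.univ.filter fun i => ¬ i ∈ _) (fun i hi => by
      rw [Finset.mem_filter, hiff] at hi
      exact Set.indicator_of_notMem hi.2 _), add_zero]
    rw [Finset.filter_mem_eq_inter, Finset.univ_inter]
    exact Finset.sum_congr rfl fun i hi => (Set.indicator_of_mem ((hiff i).1 hi)
      fun ω => ‖statMap X f g (iterate X g ft γ x0 ω k) i‖ ^ 2).symm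
  rw [e1, e2, Finset.mul_sum]
  exact Finset.sum_le_sum fun i _ => hC.integral_le i k (fun ω => sq_nonneg _) (hpre i)

end Algorithm

end AsyFlexa

namespace AsyFlexa

/-! ### Bounds in expectation and their almost sure consequences. -/

section Bounds

variable {N : ℕ} {n : Fin N → ℕ} {X : ∀ i, Set (EuclideanSpace ℝ (Fin (n i)))}
  {O : Set (Vec n)} {f : Vec n → ℝ} {g : ∀ i, EuclideanSpace ℝ (Fin (n i)) → ℝ} {Lf Lg : ℝ≥0}
  {ft : ∀ i, EuclideanSpace ℝ (Fin (n i)) → Vec n → ℝ} {c : ℝ} {LB LE : ℝ≥0} {γ : ℝ} {δ T : ℕ}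
  {D : Finset (Fin N → ℕ)} {P : Measure (Sample D)} {pmin : ℝ} {x0 : Vec n}

/-- An update at `t` is a past update at `l = max k (t + 1)`; for `t ≥ k` this needs `δ ≥ 1`, since
the past window must reach back one iteration. -/
theorem one_le_maxUpdates {ω : Sample D} {i : Fin N} {k t : ℕ} (hδ : 1 ≤ δ)
    (ht : t ∈ updates δ T ω i k) : 1 ≤ maxUpdates δ T ω i k := by
  obtain ⟨h1, h2⟩ := Finset.mem_filter.1 ht
  rw [Finset.mem_Ico] at h1
  have hl : max k (t + 1) ∈ Finset.Icc k (k + T) := Finset.mem_Icc.2 ⟨le_max_left _ _, by omega⟩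
  have hp : t ∈ pastUpdates δ ω i (max k (t + 1)) :=
    Finset.mem_filter.2 ⟨Finset.mem_Ico.2 ⟨by omega, by omega⟩, h2⟩
  exact (Nat.succ_le_of_lt (Finset.card_pos.2 ⟨t, hp⟩)).trans
    (Finset.le_sup (f := fun l => (pastUpdates δ ω i l).card) hl)

theorem sum_le_weightedDecrease {F : Vec n → ℝ} {L : ℝ} {x : ℕ → Vec n} {ω : Sample D} (hδ : 1 ≤ δ)
    (hdec : ∀ t, 0 ≤ lyapunov F δ L x t - lyapunov F δ L x (t + 1)) (k : ℕ) :
    ∑ t ∈ Finset.Ico (k - 1) (k + T), (lyapunov F δ L x t - lyapunov F δ L x (t + 1))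
      ≤ weightedDecrease F δ T L x ω k := by
  calc _ ≤ ∑ t ∈ Finset.Ico (k - δ) (k + T), (lyapunov F δ L x t - lyapunov F δ L x (t + 1)) :=
        Finset.sum_le_sum_of_subset_of_nonneg
          (Finset.Ico_subset_Ico_left (Nat.sub_le_sub_left hδ k)) fun t _ _ => hdec t
    _ = ∑ i : Fin N, ∑ t ∈ updates δ T ω i k,
          (lyapunov F δ L x t - lyapunov F δ L x (t + 1)) :=
        (Finset.sum_fiberwise _ (fun t => (ω t).1) _).symm
    _ ≤ _ := by
        refine Finset.sum_le_sum fun i _ => ?_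
        rcases (updates δ T ω i k).eq_empty_or_nonempty with h | ⟨t, ht⟩
        · simp [h]
        · refine le_mul_of_one_le_left (Finset.sum_nonneg fun t _ => hdec t) ?_
          exact_mod_cast one_le_maxUpdates hδ ht

/-- The shift `k ↦ k + 1` leaves the short windows plus one last term each. These terms and the
initial window, shortened by truncated subtraction, fill `0, …, K + T - 1`. -/
theorem sum_window_eq (v : ℕ → ℝ) (K T : ℕ) :
    ∑ k ∈ Finset.range (K + 1), ∑ t ∈ Finset.Ico (k - 1) (k + T), v t
      = ∑ k ∈ Finset.range K, ∑ l ∈ Finset.range T, v (k + l)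
        + ∑ s ∈ Finset.range (K + T), v s := by
  rw [Finset.sum_range_succ']
  have h1 : ∀ k, ∑ t ∈ Finset.Ico (k + 1 - 1) (k + 1 + T), v t
      = ∑ l ∈ Finset.range T, v (k + l) + v (T + k) := by
    intro k
    rw [Finset.sum_Ico_eq_sum_range, show k + 1 + T - (k + 1 - 1) = T + 1 by omega,
      Finset.sum_range_succ, Nat.add_sub_cancel, add_comm k T]
  have h0 : ∑ t ∈ Finset.Ico (0 - 1) (0 + T), v t = ∑ t ∈ Finset.range T, v t := by
    simp
  rw [h0, Finset.sum_congr rfl fun k _ => h1 k, Finset.sum_add_distrib, add_comm K T,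
    Finset.sum_range_add]
  ring

theorem decreaseRate_pos (hγ0 : 0 < γ) (hγ : γ * (Lf + (δ : ℝ) ^ 2 * Lf / 2) < c) :
    0 < decreaseRate γ c Lf δ :=
  mul_pos hγ0 (sub_pos.2 hγ)

theorem meanSqStat_nonneg (k : ℕ) : 0 ≤ meanSqStat P X f g ft γ x0 k :=
  integral_nonneg fun _ => sq_nonneg _

/-- Nonnegative random variables with summable expectations converge to zero almost surely. -/
theorem ae_tendsto_of_summable_integral {Ω : Type*} [MeasurableSpace Ω] {μ : Measure Ω}
    {h : ℕ → Ω → ℝ} (h0 : ∀ k ω, 0 ≤ h k ω) (hint : ∀ k, Integrable (h k) μ)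
    (hsum : Summable fun k => ∫ ω, h k ω ∂μ) :
    ∀ᵐ ω ∂μ, Tendsto (fun k => h k ω) atTop (𝓝 0) := by
  have hm : ∀ k, AEMeasurable (fun ω => ENNReal.ofReal (h k ω)) μ := fun k =>
    (hint k).aestronglyMeasurable.aemeasurable.ennreal_ofReal
  -- By Tonelli the random series has finite expectation, hence is finite almost surely.
  have hfin : ∫⁻ ω, ∑' k, ENNReal.ofReal (h k ω) ∂μ ≠ ⊤ := by
    rw [lintegral_tsum hm]
    have e : ∀ k, ∫⁻ ω, ENNReal.ofReal (h k ω) ∂μ = ENNReal.ofReal (∫ ω, h k ω ∂μ) := fun k =>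
      (ofReal_integral_eq_lintegral_ofReal (hint k) (Eventually.of_forall (h0 k))).symm
    simp only [e]
    exact hsum.tsum_ofReal_ne_top
  filter_upwards [ae_lt_top' (AEMeasurable.tsum hm) hfin] with ω hω
  have h1 := ENNReal.tendsto_atTop_zero_of_tsum_ne_top hω.ne
  have h2 := (ENNReal.tendsto_toReal ENNReal.zero_ne_top).comp h1
  simpa [Function.comp_def, ENNReal.toReal_ofReal (h0 _ _)] using h2

theorem isStationary_of_mapClusterPt (hA : AssumptionA X O f g Lf Lg) {u : ℕ → Vec n}
    (hu : ∀ k, u k ∈ feasible X) (hlim : Tendsto (fun k => statMap X f g (u k)) atTop (𝓝 0))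
    {x : Vec n} (hx : MapClusterPt x atTop u) : IsStationary X f g x := by
  obtain ⟨ψ, hψ, hψx⟩ := hx.tendsto_subseq
  have hmem : x ∈ feasible X :=
    (isClosed_feasible hA.isClosed).mem_of_tendsto hψx (Eventually.of_forall fun k => hu _)
  refine hA.isStationary_of_statMap_eq_zero hmem ?_
  have h1 : Tendsto (fun k => statMap X f g (u (ψ k))) atTop (𝓝 (statMap X f g x)) :=
    (hA.continuousOn_statMap x hmem).tendsto.comp
      (tendsto_nhdsWithin_iff.2 ⟨hψx, Eventually.of_forall fun k => hu _⟩)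
  exact tendsto_nhds_unique h1 (hlim.comp hψ.tendsto_atTop)

/-- Every iteration before `K_ε` has mean squared stationarity above `ε`. -/
theorem mul_firstIter_le {ε : ℝ} :
    ε * firstIter P X f g ft γ x0 ε
      ≤ ∑ k ∈ Finset.range (firstIter P X f g ft γ x0 ε), meanSqStat P X f g ft γ x0 k := by
  calc ε * firstIter P X f g ft γ x0 ε
      = ∑ _k ∈ Finset.range (firstIter P X f g ft γ x0 ε), ε := by simp [mul_comm]
    _ ≤ _ := Finset.sum_le_sum fun k hk => by
        have := Nat.notMem_of_lt_sInf (Finset.mem_range.1 hk)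
        exact (not_le.1 this).le

variable [IsProbabilityMeasure P]

/-- The cumulated mean stationarity is bounded by a multiple of the initial optimality gap. -/
theorem sum_meanSqStat_le (hA : AssumptionA X O f g Lf Lg) (hB : AssumptionB X f ft c LB LE)
    (hC : AssumptionC P δ T pmin) (hγ0 : 0 < γ) (hγ1 : γ ≤ 1) (hx0 : x0 ∈ feasible X)
    (hγ : γ * (Lf + (δ : ℝ) ^ 2 * Lf / 2) < c) (K : ℕ) :
    decreaseRate γ c Lf δ * pmin * ∑ k ∈ Finset.range K, meanSqStat P X f g ft γ x0 k
      ≤ (2 * ((1 + LE) * (1 + LB + LE)) + 2 * T * LB * (1 + LB + LE) * γ ^ 2) * (T + 1)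
        * (objective f g x0 - sInf (objective f g '' feasible X)) := by
  have hrate := decreaseRate_pos hγ0 hγ
  calc _ = decreaseRate γ c Lf δ * ∑ k ∈ Finset.range K, pmin * meanSqStat P X f g ft γ x0 k := by
        rw [Finset.mul_sum, Finset.mul_sum]
        exact Finset.sum_congr rfl fun k _ => by ring
    _ ≤ decreaseRate γ c Lf δ * ∑ k ∈ Finset.range K,
          ∫ ω, windowStat X f g T (iterate X g ft γ x0 ω) (fun k => (ω k).1) k ∂P :=
        mul_le_mul_of_nonneg_left
          (Finset.sum_le_sum fun k _ => pmin_mul_meanSqStat_le hC k) hrate.le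
    _ = ∫ ω, decreaseRate γ c Lf δ * ∑ k ∈ Finset.range K,
          windowStat X f g T (iterate X g ft γ x0 ω) (fun k => (ω k).1) k ∂P := by
        rw [integral_const_mul, integral_finsetSum _ fun k _ => integrable_windowStat P T k]
    _ ≤ ∫ _ω, (2 * ((1 + LE) * (1 + LB + LE)) + 2 * T * LB * (1 + LB + LE) * γ ^ 2) * (T + 1)
        * (objective f g x0 - sInf (objective f g '' feasible X)) ∂P := by
        refine integral_mono_ae ((integrable_finsetSum _ fun k _ =>
          integrable_windowStat P T k).const_mul _) (integrable_const _) ?_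
        filter_upwards [hC.own_block] with ω hω
        have hrun := isRun_iterate hA hB hC hγ0 hγ1 hx0 hω
        have h1 := hrun.sum_windowStat_le hA hB hγ0 hγ1 hγ hC.T_pos K
        have h2 := hrun.sum_gapSq_le hA hB hγ0 hγ1 (K + T)
        rw [iterate_zero] at h2
        -- Each gap is counted in at most `T` windows; this crude bound gives a constant free of
        -- `K`.
        have h3 : ∑ k ∈ Finset.range K, ∑ l ∈ Finset.range T,
            gapSq X g ft (iterate X g ft γ x0 ω) (fun k => (ω k).1)
              (fun k => WithLp.toLp 2 fun j => iterate X g ft γ x0 ω (k - (ω k).2.1 j) j) (k + l)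
            ≤ T * ∑ s ∈ Finset.range (K + T),
              gapSq X g ft (iterate X g ft γ x0 ω) (fun k => (ω k).1)
                (fun k => WithLp.toLp 2 fun j => iterate X g ft γ x0 ω (k - (ω k).2.1 j) j) s := by
          rw [Finset.sum_comm]
          calc _ ≤ ∑ _l ∈ Finset.range T, _ := Finset.sum_le_sum fun l hl =>
                sum_range_shift_le (fun s => IsRun.gapSq_nonneg _ _ _ s)
                  (show K + l ≤ K + T by have := Finset.mem_range.1 hl; omega)
            _ = _ := by simp
        generalize ∑ s ∈ Finset.range (K + T), gapSq X g ft _ _ _ s = S at h1 h2 h3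
        generalize ∑ k ∈ Finset.range K, ∑ l ∈ Finset.range T, gapSq X g ft _ _ _ (k + l) = S'
          at h1 h3
        have hLE : (0 : ℝ) ≤ LE := LE.2
        have hLB : (0 : ℝ) ≤ LB := LB.2
        have h4 : 2 * T * LB * (1 + LB + LE) * γ ^ 2 * (S' + S)
            ≤ 2 * T * LB * (1 + LB + LE) * γ ^ 2 * (T * S + S) :=
          mul_le_mul_of_nonneg_left (by linarith) (by positivity)
        have h5 := mul_le_mul_of_nonneg_left (h1.trans (add_le_add_right h4 _)) hrate.le
        have h6 := mul_le_mul_of_nonneg_left h2 (show 0 ≤ (2 * ((1 + (LE : ℝ)) * (1 + LB + LE))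
          + 2 * T * LB * (1 + LB + LE) * γ ^ 2) * (T + 1) by positivity)
        refine h5.trans (le_trans (le_of_eq ?_) h6)
        ring
    _ = _ := by simp

/-- The cumulated mean stationarity, bounded with the help of the weighted decreases. -/
theorem sum_meanSqStat_le_weightedDecrease (hA : AssumptionA X O f g Lf Lg)
    (hB : AssumptionB X f ft c LB LE) (hC : AssumptionC P δ T pmin) (hγ0 : 0 < γ) (hγ1 : γ ≤ 1)
    (hx0 : x0 ∈ feasible X) (hγ : γ * (Lf + (δ : ℝ) ^ 2 * Lf / 2) < c) (hδ : 1 ≤ δ) (K : ℕ) :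
    decreaseRate γ c Lf δ * pmin * ∑ k ∈ Finset.range K, meanSqStat P X f g ft γ x0 k
      ≤ 2 * ((1 + LE) * (1 + LB + LE)) * (T + 1)
          * (objective f g x0 - sInf (objective f g '' feasible X))
        + 2 * T * LB * (1 + LB + LE) * γ ^ 2 * ∑ k ∈ Finset.range (K + 1),
          ∫ ω, weightedDecrease (objective f g) δ T Lf (iterate X g ft γ x0 ω) ω k ∂P := by
  have hrate := decreaseRate_pos hγ0 hγ
  calc _ = decreaseRate γ c Lf δ * ∑ k ∈ Finset.range K, pmin * meanSqStat P X f g ft γ x0 k := by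
        rw [Finset.mul_sum, Finset.mul_sum]
        exact Finset.sum_congr rfl fun k _ => by ring
    _ ≤ decreaseRate γ c Lf δ * ∑ k ∈ Finset.range K,
          ∫ ω, windowStat X f g T (iterate X g ft γ x0 ω) (fun k => (ω k).1) k ∂P :=
        mul_le_mul_of_nonneg_left
          (Finset.sum_le_sum fun k _ => pmin_mul_meanSqStat_le hC k) hrate.le
    _ = ∫ ω, decreaseRate γ c Lf δ * ∑ k ∈ Finset.range K,
          windowStat X f g T (iterate X g ft γ x0 ω) (fun k => (ω k).1) k ∂P := by
        rw [integral_const_mul, integral_finsetSum _ fun k _ => integrable_windowStat P T k]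
    _ ≤ ∫ ω, (2 * ((1 + LE) * (1 + LB + LE)) * (T + 1)
          * (objective f g x0 - sInf (objective f g '' feasible X))
        + 2 * T * LB * (1 + LB + LE) * γ ^ 2 * ∑ k ∈ Finset.range (K + 1),
          weightedDecrease (objective f g) δ T Lf (iterate X g ft γ x0 ω) ω k) ∂P := by
        refine integral_mono_ae ((integrable_finsetSum _ fun k _ =>
          integrable_windowStat P T k).const_mul _) ((integrable_const _).add
          ((integrable_finsetSum _ fun k _ =>
            integrable_weightedDecrease P _ _ k).const_mul _)) ?_
        filter_upwards [hC.own_block] with ω hω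
        have hrun := isRun_iterate hA hB hC hγ0 hγ1 hx0 hω
        have h1 := hrun.sum_windowStat_le hA hB hγ0 hγ1 hγ hC.T_pos K
        have h2 := hrun.sum_gapSq_le hA hB hγ0 hγ1 (K + T)
        rw [iterate_zero] at h2
        have hv := hrun.lyapunov_decrease hA hB hγ0 hγ1
        have hD0 : ∀ k, 0 ≤ gapSq X g ft (iterate X g ft γ x0 ω) (fun k => (ω k).1)
          (fun k => WithLp.toLp 2 fun j => iterate X g ft γ x0 ω (k - (ω k).2.1 j) j) k :=
          fun k => IsRun.gapSq_nonneg _ _ _ k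
        generalize gapSq X g ft (iterate X g ft γ x0 ω) _ _ = d at h1 h2 hv hD0
        -- The gap sums of the pathwise bound are exactly those of the windows `[k - 1, k + T)`,
        -- which the weighted decreases cover when `δ ≥ 1`.
        have hW : decreaseRate γ c Lf δ * (∑ k ∈ Finset.range K, ∑ l ∈ Finset.range T, d (k + l)
              + ∑ s ∈ Finset.range (K + T), d s)
            ≤ ∑ k ∈ Finset.range (K + 1),
              weightedDecrease (objective f g) δ T Lf (iterate X g ft γ x0 ω) ω k := by
          calc _ ≤ ∑ k ∈ Finset.range (K + 1), ∑ t ∈ Finset.Ico (k - 1) (k + T),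
                (lyapunov (objective f g) δ Lf (iterate X g ft γ x0 ω) t
                  - lyapunov (objective f g) δ Lf (iterate X g ft γ x0 ω) (t + 1)) := by
                rw [← sum_window_eq, Finset.mul_sum]
                simp only [Finset.mul_sum]
                exact Finset.sum_le_sum fun k _ => Finset.sum_le_sum fun t _ => hv t
            _ ≤ _ := Finset.sum_le_sum fun k _ => sum_le_weightedDecrease hδ
                (fun t => (mul_nonneg hrate.le (hD0 t)).trans (hv t)) k
        generalize ∑ s ∈ Finset.range (K + T), d s = S at h1 h2 hW
        generalize ∑ k ∈ Finset.range K, ∑ l ∈ Finset.range T, d (k + l) = S' at h1 hW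
        have hLE : (0 : ℝ) ≤ LE := LE.2
        have hLB : (0 : ℝ) ≤ LB := LB.2
        have h5 := mul_le_mul_of_nonneg_left h1 hrate.le
        have h6 := mul_le_mul_of_nonneg_left h2
          (show 0 ≤ 2 * ((1 + (LE : ℝ)) * (1 + LB + LE)) * (T + 1) by positivity)
        have h7 := mul_le_mul_of_nonneg_left hW
          (show 0 ≤ 2 * T * LB * (1 + LB + LE) * γ ^ 2 by positivity)
        refine h5.trans (le_trans (le_of_eq ?_) (add_le_add h6 h7))
        ring
    _ = _ := by
        rw [integral_add (integrable_const _) ((integrable_finsetSum _ fun k _ =>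
            integrable_weightedDecrease P _ _ k).const_mul _), integral_const, probReal_univ, one_smul,
          integral_const_mul, integral_finsetSum _ fun k _ => integrable_weightedDecrease P _ _ k]

theorem summable_meanSqStat (hA : AssumptionA X O f g Lf Lg) (hB : AssumptionB X f ft c LB LE)
    (hC : AssumptionC P δ T pmin) (hγ0 : 0 < γ) (hγ1 : γ ≤ 1) (hx0 : x0 ∈ feasible X)
    (hγ : γ * (Lf + (δ : ℝ) ^ 2 * Lf / 2) < c) :
    Summable (meanSqStat P X f g ft γ x0) := by
  have hpos : 0 < decreaseRate γ c Lf δ * pmin := mul_pos (decreaseRate_pos hγ0 hγ) hC.pmin_pos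
  refine summable_of_sum_range_le (c :=
    (2 * ((1 + LE) * (1 + LB + LE)) + 2 * T * LB * (1 + LB + LE) * γ ^ 2) * (T + 1)
      * (objective f g x0 - sInf (objective f g '' feasible X))
      / (decreaseRate γ c Lf δ * pmin))
    (fun k => meanSqStat_nonneg k) fun K => ?_
  rw [le_div_iff₀ hpos, mul_comm]
  exact sum_meanSqStat_le hA hB hC hγ0 hγ1 hx0 hγ K

theorem ae_tendsto_statMap (hA : AssumptionA X O f g Lf Lg) (hB : AssumptionB X f ft c LB LE)
    (hC : AssumptionC P δ T pmin) (hγ0 : 0 < γ) (hγ1 : γ ≤ 1) (hx0 : x0 ∈ feasible X)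
    (hγ : γ * (Lf + (δ : ℝ) ^ 2 * Lf / 2) < c) :
    ∀ᵐ ω ∂P, Tendsto (fun k => statMap X f g (iterate X g ft γ x0 ω k)) atTop (𝓝 0) := by
  filter_upwards [ae_tendsto_of_summable_integral (fun k ω => sq_nonneg _)
    (fun k => integrable_statMap (X := X) (f := f) (g := g) (ft := ft) (γ := γ) (x0 := x0) P k)
    (summable_meanSqStat hA hB hC hγ0 hγ1 hx0 hγ)] with ω hω
  rw [tendsto_zero_iff_norm_tendsto_zero]
  have := (Real.continuous_sqrt.tendsto 0).comp hω
  simpa [Function.comp_def, Real.sqrt_sq (norm_nonneg _)] using this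

end Bounds

end AsyFlexa

/-! ### The main theorem. -/

theorem theorem1 {N : ℕ} {n : Fin N → ℕ}
    (X : ∀ i, Set (EuclideanSpace ℝ (Fin (n i)))) (O : Set (AsyFlexa.Vec n))
    (f : AsyFlexa.Vec n → ℝ) (g : ∀ i, EuclideanSpace ℝ (Fin (n i)) → ℝ)
    (ft : ∀ i, EuclideanSpace ℝ (Fin (n i)) → AsyFlexa.Vec n → ℝ)
    (D : Finset (Fin N → ℕ)) (P : Measure (AsyFlexa.Sample D)) [IsProbabilityMeasure P]
    (Lf Lg LB LE : ℝ≥0) (c pmin γ : ℝ) (δ T : ℕ) (x0 : AsyFlexa.Vec n)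
    (hA : AsyFlexa.AssumptionA X O f g Lf Lg)
    (hB : AsyFlexa.AssumptionB X f ft c LB LE)
    (hC : AsyFlexa.AssumptionC P δ T pmin)
    (hx0 : x0 ∈ AsyFlexa.feasible X)
    (hγ0 : 0 < γ) (hγ1 : γ ≤ 1)
    -- `γ < c / (L_f + δ² L_f / 2)`, which is no restriction if `L_f = 0`
    (hγ : γ * (Lf + (δ : ℝ) ^ 2 * Lf / 2) < c) :
    -- (a) limit points are stationary
    (∀ᵐ ω ∂P, ∀ x : AsyFlexa.Vec n,
      MapClusterPt x atTop (fun k => AsyFlexa.iterate X g ft γ x0 ω k) →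
        AsyFlexa.IsStationary X f g x) ∧
    -- (b) the objective values converge
    (∀ᵐ ω ∂P, ∃ v : ℝ,
      Tendsto (fun k => AsyFlexa.objective f g (AsyFlexa.iterate X g ft γ x0 ω k)) atTop (𝓝 v)) ∧
    -- (c) the expectations exist, `K_ε` exists and is `O(1/ε)`, and the explicit bound holds
    (∀ k, Integrable
      (fun ω => ‖AsyFlexa.statMap X f g (AsyFlexa.iterate X g ft γ x0 ω k)‖ ^ 2) P) ∧
    (∀ k, Integrable
      (fun ω => AsyFlexa.weightedDecrease (AsyFlexa.objective f g) δ T Lf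
        (AsyFlexa.iterate X g ft γ x0 ω) ω k) P) ∧
    (∀ ε : ℝ, 0 < ε → ∃ k, AsyFlexa.meanSqStat P X f g ft γ x0 k ≤ ε) ∧
    (∃ C : ℝ, ∀ ε : ℝ, 0 < ε → (AsyFlexa.firstIter P X f g ft γ x0 ε : ℝ) ≤ C / ε) ∧
    (1 ≤ δ → ∀ α : ℝ, 0 < α → α < 1 → ∀ ε : ℝ, 0 < ε →
      (AsyFlexa.firstIter P X f g ft γ x0 ε : ℝ) ≤
        AsyFlexa.constC1 N δ γ c Lf LB LE pmin α * (T + 1) *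
            (AsyFlexa.objective f g x0 - sInf (AsyFlexa.objective f g '' AsyFlexa.feasible X)) / ε +
          AsyFlexa.constC2 δ T γ c Lf LB LE pmin α * γ ^ 2 / ε *
            ∑ k ∈ Finset.range (AsyFlexa.firstIter P X f g ft γ x0 ε + 1),
              ∫ ω, AsyFlexa.weightedDecrease (AsyFlexa.objective f g) δ T Lf
                (AsyFlexa.iterate X g ft γ x0 ω) ω k ∂P) := by
  open AsyFlexa in
  have hrate : 0 < decreaseRate γ c Lf δ := decreaseRate_pos hγ0 hγ
  have hsum := summable_meanSqStat hA hB hC hγ0 hγ1 hx0 hγ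
  refine ⟨?_, ?_, fun k => integrable_statMap P k, fun k => integrable_weightedDecrease P _ _ k,
    ?_, ?_, ?_⟩
  · filter_upwards [ae_tendsto_statMap hA hB hC hγ0 hγ1 hx0 hγ] with ω hω x hx
    exact isStationary_of_mapClusterPt hA (iterate_mem hA hB hγ0 hγ1 hx0 ω) hω hx
  · filter_upwards [hC.own_block] with ω hω
    exact (isRun_iterate hA hB hC hγ0 hγ1 hx0 hω).tendsto_objective hA hB hγ0 hγ1 hrate
  · intro ε hε
    exact (hsum.tendsto_atTop_zero.eventually_le_const hε).exists
  -- The total mean stationarity serves as the constant for every `ε`.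
  · refine ⟨∑' k, meanSqStat P X f g ft γ x0 k, fun ε hε => ?_⟩
    rw [le_div_iff₀ hε, mul_comm]
    exact mul_firstIter_le.trans (hsum.sum_le_tsum _ fun k _ => meanSqStat_nonneg k)
  · intro hδ α hα0 hα1 ε hε
    have hpmin := hC.pmin_pos
    set K := firstIter P X f g ft γ x0 ε with hK
    have h1 := sum_meanSqStat_le_weightedDecrease hA hB hC hγ0 hγ1 hx0 hγ hδ K
    have h2 : ε * K ≤ _ := mul_firstIter_le (P := P) (X := X) (f := f) (g := g) (ft := ft) (γ := γ)
      (x0 := x0)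
    have hgap : 0 ≤ objective f g x0 - sInf (objective f g '' feasible X) :=
      sub_nonneg.2 (hA.sInf_le_objective hx0)
    have hden : 0 < decreaseRate γ c Lf δ * (pmin - pmin * α) :=
      mul_pos hrate (by nlinarith)
    set G := objective f g x0 - sInf (objective f g '' feasible X)
    set W := ∑ k ∈ Finset.range (K + 1),
      ∫ ω, weightedDecrease (objective f g) δ T Lf (iterate X g ft γ x0 ω) ω k ∂P
    have hLE : (0 : ℝ) ≤ LE := LE.2
    have hLB : (0 : ℝ) ≤ LB := LB.2
    have hLf : (0 : ℝ) ≤ Lf := Lf.2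
    -- The estimate holds with `pmin`; replacing it by the smaller `pmin - pmin * α` only weakens
    -- it.
    have h3 : decreaseRate γ c Lf δ * (pmin - pmin * α) * (ε * K)
        ≤ decreaseRate γ c Lf δ * pmin
          * ∑ k ∈ Finset.range K, meanSqStat P X f g ft γ x0 k := by
      refine mul_le_mul (mul_le_mul_of_nonneg_left ?_ hrate.le) h2 (by positivity) (by positivity)
      have := mul_pos hpmin hα0
      linarith
    have h4 : 2 * ((1 + (LE : ℝ)) * (1 + LB + LE)) * (T + 1) * G
        ≤ 2 * (1 + (1 + LE) * (1 + LB + LE)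
          + γ ^ 2 * N * pmin * α⁻¹ * (1 + ((Lf : ℝ) + 1) ^ 2)) * (T + 1) * G := by
      have : 0 ≤ γ ^ 2 * N * pmin * α⁻¹ * (1 + ((Lf : ℝ) + 1) ^ 2) := by positivity
      gcongr
      linarith
    have h5 := h3.trans (h1.trans (add_le_add_left h4 _))
    have e : constC1 N δ γ c Lf LB LE pmin α * (T + 1) * G / ε
          + constC2 δ T γ c Lf LB LE pmin α * γ ^ 2 / ε * W
        = (2 * (1 + (1 + LE) * (1 + LB + LE)
            + γ ^ 2 * N * pmin * α⁻¹ * (1 + ((Lf : ℝ) + 1) ^ 2)) * (T + 1) * G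
          + 2 * T * LB * (1 + LB + LE) * γ ^ 2 * W)
          / (decreaseRate γ c Lf δ * (pmin - pmin * α) * ε) := by
      unfold constC1 constC2
      rw [show γ * (c - γ * (Lf + (δ : ℝ) ^ 2 * Lf / 2)) = decreaseRate γ c Lf δ from rfl]
      field_simp
    rw [e, le_div_iff₀ (mul_pos hden hε)]
    linarith
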